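/- Let $Q\subset\mathbb{R}^2$ be a convex polygon with $M\ge 3$ vertices, interior angles $\alpha_1,\dots,\alpha_M\in(0,\pi)$ and total edge length $|\partial Q|$. For each integer $n\ge 3$ let $X_1,\dots,X_n$ be independent random points uniformly distributed on the boundary $\partial Q$ (with respect to normalized arc length), and let $Q_n=[X_1,\dots,X_n]$ be their convex hull. Let $\delta_H$ denote the Hausdorff distance. If $\alpha_i\ge \pi/2$ for all $i=1,\dots,M$, then the limit $\lim_{n\to\infty} n\,\mathbb{E}[\delta_H(Q,Q_n)]$ exists in $\mathbb{R}$ and $$\frac15\,A(Q)\;\le\;\lim_{n\to\infty} n\,\mathbb{E}[\delta_H(Q,Q_n)]\;\le\;A(Q),$$ where $$A(Q):=|\partial Q|\sum_{k=1}^{M}(-1)^{k+1}\sum_{1\le i_1<\cdots<i_k\le M}\frac{1}{\frac{1}{\sin\alpha_{i_1}}+\cdots+\frac{1}{\sin\alpha_{i_k}}}.$$ -/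

import Mathlib

open MeasureTheory ProbabilityTheory Filter Topology

/-- The Euclidean plane. -/
abbrev Plane : Type := EuclideanSpace ℝ (Fin 2)

namespace Polygon

/-- The closed region spanned by the vertices of a polygon. -/
def region {M : ℕ} (p : Polygon Plane M) : Set Plane :=
  convexHull ℝ (Set.range p.vertices)

/-- `p` lists the vertices of a convex polygon once each, in the cyclic order (in either direction)
in which they follow one another along the boundary: the listed points are pairwise distinct, they
are exactly the vertices (extreme points) of their convex hull, and the edges joining consecutive
points (the last one being joined to the first) make up the topological boundary of the hull. -/
structure IsConvex {M : ℕ} (p : Polygon Plane M) : Prop where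
  injective : Function.Injective p.vertices
  extremePoints_eq : p.region.extremePoints ℝ = Set.range p.vertices
  frontier_eq : frontier p.region = p.boundary ℝ

/-- The total edge length `|∂Q|`. -/
noncomputable def perimeter {M : ℕ} (p : Polygon Plane M) : ℝ :=
  ∑ i, dist (p i) (p (finRotate M i))

/-- The interior angle of a convex polygon at its `i`-th vertex: the angle between the two edges
that meet there. -/
noncomputable def interiorAngle {M : ℕ} (p : Polygon Plane M) (i : Fin M) : ℝ :=
  EuclideanGeometry.angle (p ((finRotate M).symm i)) (p i) (p (finRotate M i))

/-- `A(Q) = |∂Q| ∑_{k=1}^M (-1)^(k+1) ∑_{i_1<...<i_k} 1 / (1/sin α_{i_1} + ... + 1/sin α_{i_k})`;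
the inner sum runs over the `k`-element sets `{i_1, ..., i_k}` of indices. -/
noncomputable def angleConstant {M : ℕ} (p : Polygon Plane M) : ℝ :=
  p.perimeter * ∑ k ∈ Finset.Icc 1 M, (-1 : ℝ) ^ (k + 1) *
    ∑ S ∈ Finset.powersetCard k (Finset.univ : Finset (Fin M)),
      1 / ∑ i ∈ S, 1 / Real.sin (p.interiorAngle i)

end Polygon

/-- The convex hull `[x_1, ..., x_n]` of finitely many points of the plane. -/
def hullOf {n : ℕ} (x : Fin n → Plane) : Set Plane :=
  convexHull ℝ (Set.range x)

/-! The distance to a convex set is a convex function, so the Hausdorff distance is attained at a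
vertex of `Q` (`hausdorffDist_convexHull_range`). Once every edge carries a sample point, the
distance from a vertex to the hull depends only on the nearest sample points on its two edges: all
others lie beyond the chord through these (`infDist_hullOf_eq_cornerDist`). Thus everything is a
continuous function, homogeneous of degree one, of the `2M` gaps between edge ends and nearest
sample points.

Small initial pieces of the edges are essentially disjoint, so the joint survival function of the
gaps is exactly `(1 - ∑ s_k / |∂Q|) ^ n` at small levels `s_k ≥ 0`. Rescaled by `n`, the gaps
converge in law to independent exponentials of rate `1 / |∂Q|`. Tails that are exponentially small
uniformly in `n` turn this into convergence of means (`tendsto_integral_maxVertexDist`).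

The limit is the mean of the largest corner distance. At a corner of angle `α ≥ π/2` with legs `x,
y`, this distance lies between `(sin α / 2) * min x y` and `sin α * min x y`. The minimum of two
such exponentials has rate `2 / |∂Q|`, and inclusion-exclusion computes the mean maximum. The limit
therefore lies between `A(Q)/4` and `A(Q)/2`, which is stronger than the claim. -/

/-! ### Weak convergence from joint survival functions. -/

theorem isPiSystem_upperOrthant (ι : Type*) :
    IsPiSystem {s : Set (ι → ℝ) | ∃ t : ι → ℝ, s = {y | ∀ k, t k < y k}} := by
  rintro _ ⟨a, rfl⟩ _ ⟨b, rfl⟩ -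
  refine ⟨fun k => max (a k) (b k), ?_⟩
  ext y
  simp [forall_and]

theorem measurableSet_upperOrthant {ι : Type*} [Countable ι] (t : ι → ℝ) :
    MeasurableSet {y : ι → ℝ | ∀ k, t k < y k} := by
  rw [Set.ofPred_forall]
  exact MeasurableSet.iInter fun k => measurableSet_lt measurable_const (measurable_pi_apply k)

/-- Convergence of the joint survival functions implies convergence of the measures of
half-open boxes. -/
theorem tendsto_measureReal_box {ι : Type*} [Fintype ι]
    {μ : ℕ → Measure (ι → ℝ)} [∀ n, IsProbabilityMeasure (μ n)]
    {ν : Measure (ι → ℝ)} [IsProbabilityMeasure ν]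
    (h : ∀ t : ι → ℝ, Tendsto (fun n => (μ n).real {y | ∀ k, t k < y k}) atTop
      (𝓝 (ν.real {y | ∀ k, t k < y k}))) (a b : ι → ℝ) :
    Tendsto (fun n => (μ n).real {y | ∀ k, a k < y k ∧ y k ≤ b k}) atTop
      (𝓝 (ν.real {y | ∀ k, a k < y k ∧ y k ≤ b k})) := by
  classical
  let O : (ι → ℝ) → Set (ι → ℝ) := fun t => {y | ∀ k, t k < y k}
  -- A box is the orthant at `a` minus the orthants with one coordinate of the corner raised to `b
  -- k`. The `max` keeps these inside the orthant at `a` even when `b k < a k`.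
  let T : Finset (Set (ι → ℝ)) :=
    Finset.univ.image fun k => O (Function.update a k (max (a k) (b k)))
  have hT : ∀ s ∈ T, s ∈ {s : Set (ι → ℝ) | ∃ t : ι → ℝ, s = {y | ∀ k, t k < y k}} := by
    intro s hs
    obtain ⟨k, -, rfl⟩ := Finset.mem_image.1 hs
    exact ⟨_, rfl⟩
  have hU := (isPiSystem_upperOrthant ι).tendsto_measureReal_biUnion (μ := μ) (ν := ν)
    (l := atTop) hT
    (by rintro _ ⟨t, rfl⟩; exact measurableSet_upperOrthant t)
    (by rintro _ ⟨t, rfl⟩; exact h t)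
  have hTO : (⋃ s ∈ T, s) ⊆ O a := by
    refine Set.iUnion₂_subset fun s hs => ?_
    obtain ⟨k, -, rfl⟩ := Finset.mem_image.1 hs
    intro y hy j
    have := hy j
    by_cases hj : j = k
    · subst hj
      simp only [Function.update_self] at this
      exact (le_max_left _ _).trans_lt this
    · simpa [Function.update_of_ne hj] using this
  have hbox : {y : ι → ℝ | ∀ k, a k < y k ∧ y k ≤ b k} = O a \ ⋃ s ∈ T, s := by
    ext y
    simp only [Set.mem_ofPred_eq, Set.mem_sdiff, O, T, Finset.mem_image, Finset.mem_univ, true_and,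
      Set.iUnion_exists, Set.iUnion_iUnion_eq', Set.mem_iUnion, not_exists]
    constructor
    · intro hy
      refine ⟨fun k => (hy k).1, fun k hk => ?_⟩
      have := hk k
      simp only [Function.update_self] at this
      exact absurd ((le_max_right _ _).trans_lt this) (not_lt.2 (hy k).2)
    · rintro ⟨hy, hk⟩ k
      refine ⟨hy k, not_lt.1 fun hlt => hk k fun j => ?_⟩
      by_cases hj : j = k
      · subst hj
        simpa using ⟨hy j, hlt⟩
      · simpa [Function.update_of_ne hj] using hy j
  have hmeas : MeasurableSet (⋃ s ∈ T, s) := by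
    refine Finset.measurableSet_biUnion _ fun s hs => ?_
    obtain ⟨t, rfl⟩ := hT s hs
    exact measurableSet_upperOrthant t
  have hdiff : ∀ (m : Measure (ι → ℝ)) [IsProbabilityMeasure m],
      m.real (O a \ ⋃ s ∈ T, s) = m.real (O a) - m.real (⋃ s ∈ T, s) :=
    fun m _ => measureReal_sdiff hTO hmeas
  simp_rw [hbox, hdiff]
  exact (h a).sub hU

/-- Pointwise convergence of the joint survival functions implies weak convergence. -/
theorem tendsto_probabilityMeasure_of_tendsto_upperOrthant {ι : Type*} [Fintype ι]
    {μ : ℕ → ProbabilityMeasure (ι → ℝ)} {ν : ProbabilityMeasure (ι → ℝ)}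
    (h : ∀ t : ι → ℝ, Tendsto (fun n => (μ n : Measure (ι → ℝ)).real {y | ∀ k, t k < y k}) atTop
      (𝓝 ((ν : Measure (ι → ℝ)).real {y | ∀ k, t k < y k}))) :
    Tendsto μ atTop (𝓝 ν) := by
  -- Half-open boxes form a π-system containing arbitrarily small neighbourhoods of every point;
  -- convergence on such a family suffices.
  have hpi : IsPiSystem {s : Set (ι → ℝ) |
      ∃ a b : ι → ℝ, s = {y | ∀ k, a k < y k ∧ y k ≤ b k}} := by
    rintro _ ⟨a, b, rfl⟩ _ ⟨c, d, rfl⟩ -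
    refine ⟨fun k => max (a k) (c k), fun k => min (b k) (d k), ?_⟩
    ext y
    simp only [Set.mem_inter_iff, Set.mem_ofPred_eq, max_lt_iff, le_min_iff]
    grind
  refine hpi.tendsto_probabilityMeasure_of_tendsto_of_mem ?_ ?_ ?_
  · rintro _ ⟨a, b, rfl⟩
    rw [Set.ofPred_forall]
    exact MeasurableSet.iInter fun k => (measurable_pi_apply k) measurableSet_Ioc
  · intro u hu x hx
    obtain ⟨ε, hε, hball⟩ := Metric.isOpen_iff.1 hu x hx
    refine ⟨_, ⟨fun k => x k - ε / 2, fun k => x k + ε / 2, rfl⟩, ?_, fun y hy => hball ?_⟩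
    · have := set_pi_mem_nhds (i := (Set.univ : Set ι)) (x := x)
        (s := fun k => Set.Ioc (x k - ε / 2) (x k + ε / 2)) Set.finite_univ
        fun k _ => Ioc_mem_nhds (by linarith) (by linarith)
      filter_upwards [this] with y hy k using hy k trivial
    · refine (dist_pi_lt_iff hε).2 fun k => ?_
      rw [Real.dist_eq, abs_lt]
      have := hy k
      constructor <;> linarith [this.1, this.2]
  · rintro _ ⟨a, b, rfl⟩
    have := tendsto_measureReal_box h a b
    rw [← NNReal.tendsto_coe]
    exact this

/-! ### Convergence of tails and of means. -/

/-- Convergence of means from convergence of tails that decay exponentially, uniformly in `n`. -/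
theorem tendsto_integral_of_tendsto_tail {Ω : ℕ → Type*} [∀ n, MeasurableSpace (Ω n)]
    {P : ∀ n, Measure (Ω n)} [∀ n, IsProbabilityMeasure (P n)] {Y : ∀ n, Ω n → ℝ}
    (hint : ∀ᶠ n in atTop, Integrable (Y n) (P n)) (hnonneg : ∀ n ω, 0 ≤ Y n ω)
    {C c : ℝ} (hc : 0 < c)
    (htail : ∀ᶠ n in atTop, ∀ t, 0 < t → (P n).real {ω | t < Y n ω} ≤ C * Real.exp (-c * t))
    {F : ℝ → ℝ} (hF : ∀ᵐ t ∂(volume.restrict (Set.Ioi (0 : ℝ))),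
      Tendsto (fun n => (P n).real {ω | t < Y n ω}) atTop (𝓝 (F t))) :
    Tendsto (fun n => ∫ ω, Y n ω ∂(P n)) atTop (𝓝 (∫ t in Set.Ioi 0, F t)) := by
  have key : Tendsto (fun n => ∫ t in Set.Ioi 0, (P n).real {ω | t < Y n ω}) atTop
      (𝓝 (∫ t in Set.Ioi 0, F t)) := by
    refine tendsto_integral_filter_of_dominated_convergence (fun t => C * Real.exp (-c * t))
      (Eventually.of_forall fun n => ?_) ?_ ?_ hF
    · refine (Antitone.measurable fun s t hst => ?_).aestronglyMeasurable
      exact measureReal_mono fun ω hω => hst.trans_lt hω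
    · filter_upwards [htail] with n hn
      filter_upwards [ae_restrict_mem measurableSet_Ioi] with t ht
      rw [Real.norm_of_nonneg measureReal_nonneg]
      exact hn t ht
    · exact (exp_neg_integrableOn_Ioi 0 hc).const_mul C
  refine key.congr' ?_
  filter_upwards [hint] with n hn
  exact (hn.integral_eq_integral_meas_lt (Eventually.of_forall (hnonneg n))).symm

/-- The push-forward of a finite measure has at most countably many atoms. This supplies almost
every level for `tendsto_measureReal_superlevel`, with no need to show that the limit law is
continuous. -/
theorem ae_measure_level_eq_zero {E : Type*} [MeasurableSpace E] {ν : Measure E} [IsFiniteMeasure ν]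
    {f : E → ℝ} (hf : Measurable f) : ∀ᵐ t : ℝ, ν {y | f y = t} = 0 := by
  have hcount : {t : ℝ | 0 < ν.map f {t}}.Countable :=
    Measure.countable_meas_pos_of_disjoint_iUnion₀ (μ := ν.map f) (As := fun t : ℝ => {t})
      (fun t => (measurableSet_singleton t).nullMeasurableSet)
      (fun s t hst => (Set.disjoint_singleton.2 hst).aedisjoint)
  filter_upwards [hcount.ae_notMem volume] with t ht
  have := not_lt.1 ht
  rw [Measure.map_apply hf (measurableSet_singleton t)] at this
  exact le_antisymm this bot_le

/-- If `f` is continuous, weak convergence gives convergence of the tails at all levels of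
measure zero. -/
theorem tendsto_measureReal_superlevel {E : Type*} [TopologicalSpace E] [MeasurableSpace E]
    [OpensMeasurableSpace E] [HasOuterApproxClosed E]
    {μ : ℕ → ProbabilityMeasure E} {ν : ProbabilityMeasure E} (h : Tendsto μ atTop (𝓝 ν))
    {f : E → ℝ} (hf : Continuous f) {t : ℝ} (ht : (ν : Measure E) {y | f y = t} = 0) :
    Tendsto (fun n => (μ n : Measure E).real {y | t < f y}) atTop
      (𝓝 ((ν : Measure E).real {y | t < f y})) := by
  have := ProbabilityMeasure.tendsto_measure_of_null_frontier_of_tendsto' h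
    (E := {y | t < f y}) (measure_mono_null ?_ ht)
  · exact (ENNReal.tendsto_toReal (measure_ne_top _ _)).comp this
  · intro y hy
    exact (frontier_lt_subset_eq continuous_const hf hy).symm

/-! ### Independent exponential variables and the mean of a maximum. -/

theorem measureReal_expMeasure_Ioi {r : ℝ} (hr : 0 < r) (t : ℝ) :
    (expMeasure r).real (Set.Ioi t) = Real.exp (-(r * max t 0)) := by
  have := isProbabilityMeasure_expMeasure hr
  rw [← Set.compl_Iic, probReal_compl_eq_one_sub measurableSet_Iic, ← cdf_eq_real,
    cdf_expMeasure_eq hr]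
  split_ifs with h
  · simp [h]
  · simp [(not_le.1 h).le]

/-- The law of a family of independent exponential variables with rate `r`. -/
noncomputable def expPi (ι : Type*) [Fintype ι] (r : ℝ) : Measure (ι → ℝ) :=
  Measure.pi fun _ => expMeasure r

theorem isProbabilityMeasure_expPi (ι : Type*) [Fintype ι] {r : ℝ} (hr : 0 < r) :
    IsProbabilityMeasure (expPi ι r) := by
  have := isProbabilityMeasure_expMeasure hr
  unfold expPi
  infer_instance

theorem measureReal_expPi_pi {ι : Type*} [Fintype ι] {r : ℝ} (hr : 0 < r) (s : ι → Set ℝ) :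
    (expPi ι r).real (Set.univ.pi s) = ∏ k, (expMeasure r).real (s k) := by
  have := isProbabilityMeasure_expMeasure hr
  simp [expPi, measureReal_def, Measure.pi_pi, ENNReal.toReal_prod]

theorem measureReal_expPi_upperOrthant {ι : Type*} [Fintype ι] {r : ℝ} (hr : 0 < r) (t : ι → ℝ) :
    (expPi ι r).real {y | ∀ k, t k < y k} = Real.exp (-(r * ∑ k, max (t k) 0)) := by
  have : {y : ι → ℝ | ∀ k, t k < y k} = Set.univ.pi fun k => Set.Ioi (t k) := by
    ext y; simp
  rw [this, measureReal_expPi_pi hr]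
  simp_rw [measureReal_expMeasure_Ioi hr]
  rw [← Real.exp_sum, Finset.mul_sum, Finset.sum_neg_distrib]

theorem ae_expPi_pos (ι : Type*) [Fintype ι] {r : ℝ} (hr : 0 < r) :
    ∀ᵐ y ∂(expPi ι r), ∀ k, 0 < y k := by
  have := isProbabilityMeasure_expPi ι hr
  have h := measureReal_expPi_upperOrthant hr (fun _ : ι => (0 : ℝ))
  simp only [max_self, Finset.sum_const_zero, mul_zero, neg_zero, Real.exp_zero] at h
  have hm := measurableSet_upperOrthant (fun _ : ι => (0 : ℝ))
  rw [ae_iff, ← measureReal_eq_zero_iff, ← Set.compl_ofPred, probReal_compl_eq_one_sub hm, h,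
    sub_self]

section MinTail

variable {κ : Type*} [Fintype κ] {r : ℝ} {c : κ → ℝ}

/-- The event is a product set: both coordinates over each `i ∈ u` exceed `t / c i`. Having two
coordinates per index doubles the rate. -/
theorem measureReal_expPi_biInter_min (hr : 0 < r) (hc : ∀ i, 0 < c i) (u : Finset κ)
    {t : ℝ} (ht : 0 < t) :
    (expPi (κ × Bool) r).real
        (⋂ i ∈ u, {y | t < c i * min (y (i, true)) (y (i, false))}) =
      Real.exp (-(2 * r * ∑ i ∈ u, 1 / c i) * t) := by
  classical
  have hp := isProbabilityMeasure_expMeasure hr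
  have : (⋂ i ∈ u, {y : κ × Bool → ℝ | t < c i * min (y (i, true)) (y (i, false))}) =
      Set.univ.pi fun k => if k.1 ∈ u then Set.Ioi (t / c k.1) else Set.univ := by
    ext y
    have key : ∀ i, t < c i * min (y (i, true)) (y (i, false)) ↔
        t / c i < y (i, true) ∧ t / c i < y (i, false) := fun i => by
      rw [← lt_min_iff, div_lt_iff₀' (hc i)]
    simp only [Set.mem_iInter, Set.mem_ofPred_eq, key, Set.mem_univ_pi, Prod.forall, Bool.forall_bool]
    refine forall_congr' fun i => ?_
    by_cases hi : i ∈ u <;> simp [hi, and_comm]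
  rw [this, measureReal_expPi_pi hr]
  have hterm : ∀ k : κ × Bool, (expMeasure r).real
      (if k.1 ∈ u then Set.Ioi (t / c k.1) else Set.univ) =
      Real.exp (if k.1 ∈ u then -(r * (t / c k.1)) else 0) := by
    intro k
    split_ifs
    · rw [measureReal_expMeasure_Ioi hr, max_eq_left (div_nonneg ht.le (hc _).le)]
    · simp
  simp_rw [hterm]
  rw [← Real.exp_sum, Fintype.sum_prod_type]
  simp only [Fintype.sum_bool]
  congr 1
  simp only [← two_mul]
  rw [← Finset.mul_sum, Finset.sum_ite_mem, Finset.univ_inter, neg_mul, Finset.mul_sum,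
    Finset.mul_sum, Finset.sum_mul, ← Finset.sum_neg_distrib]
  exact Finset.sum_congr rfl fun i _ => by ring

theorem measureReal_expPi_exists_min (hr : 0 < r) (hc : ∀ i, 0 < c i) {t : ℝ} (ht : 0 < t) :
    (expPi (κ × Bool) r).real {y | ∃ i, t < c i * min (y (i, true)) (y (i, false))} =
      ∑ u ∈ (Finset.univ : Finset κ).powerset with u.Nonempty,
        (-1 : ℝ) ^ (u.card + 1) * Real.exp (-(2 * r * ∑ i ∈ u, 1 / c i) * t) := by
  have hp := isProbabilityMeasure_expPi (κ × Bool) hr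
  have : {y : κ × Bool → ℝ | ∃ i, t < c i * min (y (i, true)) (y (i, false))} =
      ⋃ i ∈ (Finset.univ : Finset κ), {y | t < c i * min (y (i, true)) (y (i, false))} := by
    ext y; simp
  rw [this, measureReal_biUnion_eq_sum_powerset]
  · exact Finset.sum_congr rfl fun u _ => by rw [measureReal_expPi_biInter_min hr hc u ht]
  · intro i _
    exact measurableSet_lt measurable_const (by fun_prop)

theorem integrableOn_measureReal_exists_min (hr : 0 < r) (hc : ∀ i, 0 < c i) :
    IntegrableOn (fun t => (expPi (κ × Bool) r).real
      {y | ∃ i, t < c i * min (y (i, true)) (y (i, false))}) (Set.Ioi 0) := by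
  refine IntegrableOn.congr_fun ?_
    (fun t ht => (measureReal_expPi_exists_min hr hc ht).symm) measurableSet_Ioi
  refine integrable_finsetSum _ fun u hu => ?_
  have hpos : 0 < ∑ i ∈ u, 1 / c i :=
    Finset.sum_pos (fun i _ => one_div_pos.2 (hc i)) (Finset.mem_filter.1 hu).2
  exact (exp_neg_integrableOn_Ioi 0 (by positivity)).const_mul _

/-- The mean of a maximum of independent exponential variables, by inclusion and exclusion. -/
theorem integral_measureReal_exists_min (hr : 0 < r) (hc : ∀ i, 0 < c i) :
    ∫ t in Set.Ioi 0, (expPi (κ × Bool) r).real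
        {y | ∃ i, t < c i * min (y (i, true)) (y (i, false))} =
      (2 * r)⁻¹ * ∑ k ∈ Finset.Icc 1 (Fintype.card κ), (-1 : ℝ) ^ (k + 1) *
        ∑ S ∈ Finset.powersetCard k (Finset.univ : Finset κ), 1 / ∑ i ∈ S, 1 / c i := by
  rw [setIntegral_congr_fun measurableSet_Ioi
    (fun t ht => measureReal_expPi_exists_min hr hc ht)]
  have hpos : ∀ u ∈ (Finset.univ : Finset κ).powerset.filter (·.Nonempty),
      0 < ∑ i ∈ u, 1 / c i := fun u hu =>
    Finset.sum_pos (fun i _ => one_div_pos.2 (hc i)) (Finset.mem_filter.1 hu).2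
  rw [integral_finsetSum]
  · have hint : ∀ u ∈ (Finset.univ : Finset κ).powerset.filter (·.Nonempty),
        ∫ t in Set.Ioi 0, (-1 : ℝ) ^ (u.card + 1) * Real.exp (-(2 * r * ∑ i ∈ u, 1 / c i) * t) =
          (2 * r)⁻¹ * ((-1 : ℝ) ^ (u.card + 1) * (1 / ∑ i ∈ u, 1 / c i)) := by
      intro u hu
      have h1 := hpos u hu
      have h2 : 0 < 2 * r * ∑ i ∈ u, 1 / c i := by positivity
      rw [integral_const_mul, integral_exp_mul_Ioi (by linarith), mul_zero, Real.exp_zero]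
      field_simp
    rw [Finset.sum_congr rfl hint, ← Finset.mul_sum]
    congr 1
    -- Group the subsets by cardinality; the term `k = 0` is the empty set, which the filter
    -- excludes.
    rw [Finset.sum_filter, Finset.sum_powerset, Finset.range_eq_Ico,
      Finset.sum_eq_sum_Ico_succ_bot (Nat.succ_pos _)]
    simp only [Finset.powersetCard_zero, Finset.sum_singleton, Finset.not_nonempty_empty, if_false,
      zero_add, Finset.card_univ]
    refine Finset.sum_congr rfl fun k hk => ?_
    rw [Finset.mul_sum]
    refine Finset.sum_congr rfl fun S hS => ?_
    have hcard := (Finset.mem_powersetCard.1 hS).2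
    have hk1 := (Finset.mem_Icc.1 hk).1
    rw [if_pos (Finset.card_pos.1 (by omega)), hcard]
  · intro u hu
    have h1 := hpos u hu
    exact (exp_neg_integrableOn_Ioi 0 (by positivity)).const_mul _

end MinTail

/-! ### Distance from the apex of a corner to a chord. -/

section Corner

variable {V : Type*} [NormedAddCommGroup V] [NormedSpace ℝ V]

/-- Distance from the apex `v` of a corner to the hull of a set that contains `v + s • e` and
`v + t • f` and lies beyond the line through these two points. -/
theorem infDist_convexHull_corner {v e f : V} {s t : ℝ} (hs : 0 ≤ s) (ht : 0 ≤ t) {S : Set V}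
    (he : v + s • e ∈ S) (hf : v + t • f ∈ S)
    (hS : ∀ z ∈ S, ∃ a b : ℝ, 0 ≤ a ∧ 0 ≤ b ∧ z = v + a • e + b • f ∧ s * t ≤ a * t + b * s) :
    Metric.infDist v (convexHull ℝ S) = Metric.infDist 0 (segment ℝ (s • e) (t • f)) := by
  have hne : (segment ℝ (s • e) (t • f)).Nonempty := ⟨_, left_mem_segment ℝ _ _⟩
  have hSne : (convexHull ℝ S).Nonempty := ⟨_, subset_convexHull ℝ S he⟩
  rcases hs.eq_or_lt with rfl | hs
  · rw [zero_smul, add_zero] at he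
    rw [zero_smul, Metric.infDist_zero_of_mem (subset_convexHull ℝ S he),
      Metric.infDist_zero_of_mem (left_mem_segment ℝ _ _)]
  rcases ht.eq_or_lt with rfl | ht
  · rw [zero_smul, add_zero] at hf
    rw [zero_smul, Metric.infDist_zero_of_mem (subset_convexHull ℝ S hf),
      Metric.infDist_zero_of_mem (right_mem_segment ℝ _ _)]
  apply le_antisymm
  · refine (Metric.le_infDist hne).2 fun q hq => ?_
    obtain ⟨a, b, ha, hb, hab, rfl⟩ := hq
    refine (Metric.infDist_le_dist_of_mem (convex_convexHull ℝ S
      (subset_convexHull ℝ S he) (subset_convexHull ℝ S hf) ha hb hab)).trans_eq ?_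
    rw [dist_eq_norm, dist_eq_norm]
    congr 1
    have : v = a • v + b • v := by rw [← add_smul, hab, one_smul]
    nth_rewrite 1 [this]
    module
  -- The part of the cone beyond the chord is convex, so it contains the hull.
  · have hsub : convexHull ℝ S ⊆ {z | ∃ a b : ℝ, 0 ≤ a ∧ 0 ≤ b ∧ z = v + a • e + b • f ∧
        s * t ≤ a * t + b * s} := by
      refine convexHull_min hS ?_
      rintro _ ⟨a, b, ha, hb, rfl, hab⟩ _ ⟨a', b', ha', hb', rfl, hab'⟩ l m hl hm hlm
      refine ⟨l * a + m * a', l * b + m * b', by positivity, by positivity, ?_, ?_⟩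
      · have : v = l • v + m • v := by rw [← add_smul, hlm, one_smul]
        nth_rewrite 3 [this]
        module
      · have h1 := mul_le_mul_of_nonneg_left hab hl
        have h2 := mul_le_mul_of_nonneg_left hab' hm
        have h3 : s * t = l * (s * t) + m * (s * t) := by rw [← add_mul, hlm, one_mul]
        linarith
    refine (Metric.le_infDist hSne).2 fun z hz => ?_
    obtain ⟨a, b, ha, hb, rfl, hab⟩ := hsub hz
    -- The chord is the level `l = 1` in the cone. Dividing by `l ≥ 1` moves the point back onto the
    -- chord and does not increase its norm.
    set l := a / s + b / t with hl
    have hl1 : 1 ≤ l := by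
      rw [hl, div_add_div _ _ hs.ne' ht.ne', one_le_div (by positivity)]
      linarith
    have hl0 : 0 < l := by linarith
    have hmem : l⁻¹ • (a • e + b • f) ∈ segment ℝ (s • e) (t • f) := by
      refine ⟨l⁻¹ * (a / s), l⁻¹ * (b / t), by positivity, by positivity, ?_, ?_⟩
      · rw [← mul_add, ← hl, inv_mul_cancel₀ hl0.ne']
      · rw [smul_smul, smul_smul, mul_assoc, mul_assoc, div_mul_cancel₀ _ hs.ne',
          div_mul_cancel₀ _ ht.ne', smul_add, smul_smul, smul_smul]
    calc Metric.infDist 0 (segment ℝ (s • e) (t • f))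
        ≤ dist 0 (l⁻¹ • (a • e + b • f)) := Metric.infDist_le_dist_of_mem hmem
      _ = l⁻¹ * ‖a • e + b • f‖ := by
          rw [dist_zero_left, norm_smul, Real.norm_of_nonneg (by positivity)]
      _ ≤ ‖a • e + b • f‖ := mul_le_of_le_one_left (norm_nonneg _) (inv_le_one_of_one_le₀ hl1)
      _ = dist v (v + a • e + b • f) := by
          rw [dist_eq_norm, ← norm_neg]; congr 1; abel

/-- This homogeneity lets the factor `n` pass from the gaps to the distance. -/
theorem infDist_segment_smul {u w : V} {c : ℝ} (hc : 0 < c) (x y : ℝ) :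
    Metric.infDist 0 (segment ℝ ((c * x) • u) ((c * y) • w)) =
      c * Metric.infDist 0 (segment ℝ (x • u) (y • w)) := by
  have h := infDist_smul₀ hc.ne' (segment ℝ (x • u) (y • w)) 0
  rw [smul_zero, Real.norm_of_nonneg hc.le] at h
  rw [← h]
  congr 1
  have := image_segment ℝ (LinearMap.lsmul ℝ V c).toAffineMap (x • u) (y • w)
  simp only [LinearMap.coe_toAffineMap, LinearMap.lsmul_apply, smul_smul] at this
  rw [← this]
  rfl

end Corner

section ObtuseCorner

variable {V : Type*} [NormedAddCommGroup V] [InnerProductSpace ℝ V] {u w : V} {c : ℝ}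

open scoped RealInnerProductSpace in
theorem norm_sq_combination (hu : ‖u‖ = 1) (hw : ‖w‖ = 1) (huw : ⟪u, w⟫ = -c) (a b : ℝ) :
    ‖a • u + b • w‖ ^ 2 = a ^ 2 + b ^ 2 - 2 * c * (a * b) := by
  rw [norm_add_sq_real, norm_smul, norm_smul, hu, hw, inner_smul_left, inner_smul_right, huw]
  simp only [mul_one, Real.norm_eq_abs, sq_abs, conj_trivial]
  ring

open scoped RealInnerProductSpace in
/-- The distance from the apex of an obtuse corner to a chord is at most `sin α` times the
shorter leg. -/
theorem infDist_segment_le_of_inner_nonpos {σ : ℝ} (hu : ‖u‖ = 1) (hw : ‖w‖ = 1)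
    (huw : ⟪u, w⟫ = -c) (hc : 0 ≤ c) (hσ : 0 ≤ σ) (hσc : σ ^ 2 + c ^ 2 = 1)
    {x y : ℝ} (hx : 0 < x) (hy : 0 < y) :
    Metric.infDist 0 (segment ℝ (x • u) (y • w)) ≤ σ * min x y := by
  have main : ∀ (u w : V), ‖u‖ = 1 → ‖w‖ = 1 → ⟪u, w⟫ = -c → ∀ x y : ℝ, 0 < x → 0 < y →
      Metric.infDist 0 (segment ℝ (x • u) (y • w)) ≤ σ * x := by
    intro u w hu hw huw x y hx hy
    -- The weights select the chord point orthogonal to `w`. It equals `A • u + (c * A) • w` with `A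
    -- = y / (y + c * x) * x ≤ x`, and its norm is `σ * A`.
    have hD : 0 < y + c * x := by positivity
    have hmem : (y / (y + c * x)) • x • u + (c * x / (y + c * x)) • y • w ∈
        segment ℝ (x • u) (y • w) :=
      ⟨_, _, by positivity, by positivity, by field_simp, rfl⟩
    refine (Metric.infDist_le_dist_of_mem hmem).trans ?_
    rw [dist_zero_left, smul_smul, smul_smul]
    refine abs_le_of_sq_le_sq' ?_ (by positivity) |>.2
    rw [norm_sq_combination hu hw huw]
    have hr : y / (y + c * x) ≤ 1 := by
      rw [div_le_one hD]; nlinarith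
    have hr0 : 0 ≤ y / (y + c * x) := by positivity
    have e1 : c * x / (y + c * x) * y = c * (y / (y + c * x) * x) := by ring
    rw [e1]
    have hle : (y / (y + c * x) * x) ^ 2 ≤ x ^ 2 := by
      have : y / (y + c * x) * x ≤ x := mul_le_of_le_one_left hx.le hr
      gcongr
    nlinarith [mul_le_mul_of_nonneg_left hle (sq_nonneg σ)]
  rcases le_total x y with h | h
  · rw [min_eq_left h]
    exact main u w hu hw huw x y hx hy
  · rw [min_eq_right h, segment_symm]
    exact main w u hw hu (by rwa [real_inner_comm]) y x hy hx

open scoped RealInnerProductSpace in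
-- A chord point `A • u + B • w` has `A + B ≥ min x y`, hence `A² + B² ≥ (min x y)² / 2`. Its
-- squared norm is at least `(1 - c) (A² + B²)`, and `σ² = (1 - c)(1 + c) ≤ 2 (1 - c)`.
theorem le_infDist_segment_of_inner_nonpos {σ : ℝ} (hu : ‖u‖ = 1) (hw : ‖w‖ = 1)
    (huw : ⟪u, w⟫ = -c) (hc : 0 ≤ c) (hσc : σ ^ 2 + c ^ 2 = 1)
    {x y : ℝ} (hx : 0 < x) (hy : 0 < y) :
    σ / 2 * min x y ≤ Metric.infDist 0 (segment ℝ (x • u) (y • w)) := by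
  refine (Metric.le_infDist ⟨_, left_mem_segment ℝ _ _⟩).2 fun q hq => ?_
  obtain ⟨a, b, ha, hb, hab, rfl⟩ := hq
  rw [dist_zero_left, smul_smul, smul_smul]
  have hm : 0 < min x y := lt_min hx hy
  refine abs_le_of_sq_le_sq' ?_ (norm_nonneg _) |>.2
  rw [norm_sq_combination hu hw huw]
  set A := a * x
  set B := b * y
  have hA : 0 ≤ A := by positivity
  have hB : 0 ≤ B := by positivity
  have hsum : min x y ≤ A + B := by
    calc min x y = a * min x y + b * min x y := by rw [← add_mul, hab, one_mul]
      _ ≤ A + B := by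
        exact add_le_add (mul_le_mul_of_nonneg_left (min_le_left _ _) ha)
          (mul_le_mul_of_nonneg_left (min_le_right _ _) hb)
  have hc1 : c ≤ 1 := by nlinarith
  have h1 : (min x y) ^ 2 ≤ (A + B) ^ 2 := by gcongr
  have h2 : (A + B) ^ 2 ≤ 2 * (A ^ 2 + B ^ 2) := by nlinarith [sq_nonneg (A - B)]
  have h3 : (1 - c) * (A ^ 2 + B ^ 2) ≤ A ^ 2 + B ^ 2 - 2 * c * (A * B) := by
    nlinarith [mul_nonneg hc (sq_nonneg (A - B))]
  have h4 : σ ^ 2 ≤ 2 * (1 - c) := by nlinarith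
  have h5 : (min x y) ^ 2 ≤ 2 * (A ^ 2 + B ^ 2) := h1.trans h2
  have h6 := mul_le_mul h4 h5 (sq_nonneg _) (by linarith)
  nlinarith

end ObtuseCorner

/-! ### Distances to hulls of finitely many points. -/

section Hull

theorem hullOf_nonempty {n : ℕ} [NeZero n] (x : Fin n → Plane) : (hullOf x).Nonempty :=
  ⟨x 0, subset_convexHull ℝ _ (Set.mem_range_self 0)⟩

theorem isCompact_hullOf {n : ℕ} (x : Fin n → Plane) : IsCompact (hullOf x) :=
  (Set.finite_range x).isCompact_convexHull (𝕜 := ℝ)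

/-- Thickenings of a convex set are convex. Since `T` need not be closed, nearest points are
replaced by approximate ones, up to `ε`. -/
theorem infDist_convexHull_le {S T : Set Plane} (hT : Convex ℝ T) (hTne : T.Nonempty) {r : ℝ}
    (hr : ∀ z ∈ S, Metric.infDist z T ≤ r) {q : Plane} (hq : q ∈ convexHull ℝ S) :
    Metric.infDist q T ≤ r := by
  have hset : Convex ℝ {z | Metric.infDist z T ≤ r} := by
    intro a ha b hb l m hl hm hlm
    rw [Set.mem_ofPred_eq]
    refine le_of_forall_pos_lt_add fun ε hε => ?_
    obtain ⟨a', ha', haa⟩ := (Metric.infDist_lt_iff hTne).1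
      (lt_of_le_of_lt ha (by linarith : r < r + ε))
    obtain ⟨b', hb', hbb⟩ := (Metric.infDist_lt_iff hTne).1
      (lt_of_le_of_lt hb (by linarith : r < r + ε))
    refine (Metric.infDist_le_dist_of_mem (hT ha' hb' hl hm hlm)).trans_lt ?_
    have hle := convex_ball (0 : Plane) (r + ε)
      (x := a - a') (by simpa [dist_eq_norm] using haa)
      (y := b - b') (by simpa [dist_eq_norm] using hbb) hl hm hlm
    rw [mem_ball_zero_iff] at hle
    rw [dist_eq_norm]
    convert! hle using 2
    module
  exact convexHull_min hr hset hq

/-- Moving each spanning point by at most `d` moves the hull by at most `d`, so the function is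
1-Lipschitz. -/
theorem continuous_infDist_hullOf {n : ℕ} [NeZero n] (v : Plane) :
    Continuous fun x : Fin n → Plane => Metric.infDist v (hullOf x) := by
  refine (LipschitzWith.of_le_add fun x y => ?_ : LipschitzWith 1 _).continuous
  have hxy : ∀ q ∈ hullOf y, Metric.infDist q (hullOf x) ≤ dist x y := by
    intro q hq
    refine infDist_convexHull_le (convex_convexHull ℝ _) (hullOf_nonempty x) ?_ hq
    rintro _ ⟨j, rfl⟩
    refine (Metric.infDist_le_dist_of_mem (subset_convexHull ℝ _ (Set.mem_range_self j))).trans ?_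
    rw [dist_comm]
    exact dist_le_pi_dist x y j
  obtain ⟨q, hq, hvq⟩ := (isCompact_hullOf y).exists_infDist_eq_dist (hullOf_nonempty y) v
  rw [hvq]
  calc Metric.infDist v (hullOf x) ≤ Metric.infDist q (hullOf x) + dist v q :=
        Metric.infDist_le_infDist_add_dist
    _ ≤ dist v q + dist x y := by linarith [hxy q hq]

theorem continuous_infDist_segment (u w : Plane) :
    Continuous fun z : ℝ × ℝ => Metric.infDist 0 (segment ℝ (z.1 • u) (z.2 • w)) := by
  have h : ∀ a b : Plane, segment ℝ a b = hullOf ![a, b] := fun a b => by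
    rw [hullOf, Matrix.range_cons_cons_empty, convexHull_pair]
  simp_rw [h]
  refine (continuous_infDist_hullOf (n := 2) 0).comp (continuous_pi fun i => ?_)
  fin_cases i
  · exact continuous_fst.smul continuous_const
  · exact continuous_snd.smul continuous_const

/-- The distance from a convex set is maximised over a hull at one of the spanning points. -/
theorem hausdorffDist_convexHull_range {κ : Type*} [Fintype κ] [Nonempty κ] (a : κ → Plane)
    {n : ℕ} [NeZero n] {x : Fin n → Plane} (hx : ∀ j, x j ∈ convexHull ℝ (Set.range a)) :
    Metric.hausdorffDist (convexHull ℝ (Set.range a)) (hullOf x) =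
      Finset.univ.sup' Finset.univ_nonempty fun i => Metric.infDist (a i) (hullOf x) := by
  have hsub : hullOf x ⊆ convexHull ℝ (Set.range a) :=
    convexHull_min (by rintro _ ⟨j, rfl⟩; exact hx j) (convex_convexHull ℝ _)
  have hbd : Bornology.IsBounded (convexHull ℝ (Set.range a)) :=
    ((Set.finite_range a).isCompact_convexHull (𝕜 := ℝ)).isBounded
  have hle : ∀ i, Metric.infDist (a i) (hullOf x) ≤
      Finset.univ.sup' Finset.univ_nonempty fun i => Metric.infDist (a i) (hullOf x) :=
    fun i => Finset.le_sup' (fun i => Metric.infDist (a i) (hullOf x)) (Finset.mem_univ i)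
  have h0 := Metric.infDist_nonneg.trans (hle (Classical.arbitrary κ))
  apply le_antisymm
  · refine Metric.hausdorffDist_le_of_infDist h0 (fun q hq => ?_) fun q hq => ?_
    · refine infDist_convexHull_le (convex_convexHull ℝ _) (hullOf_nonempty x) ?_ hq
      rintro _ ⟨i, rfl⟩
      exact hle i
    · rw [Metric.infDist_zero_of_mem (hsub hq)]
      exact h0
  · refine Finset.sup'_le _ _ fun i _ => ?_
    refine Metric.infDist_le_hausdorffDist_of_mem (subset_convexHull ℝ _ (Set.mem_range_self i)) ?_
    exact Metric.hausdorffEDist_ne_top_of_nonempty_of_bounded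
      ⟨_, subset_convexHull ℝ _ (Set.mem_range_self i)⟩ (hullOf_nonempty x) hbd (hbd.subset hsub)

end Hull

/-! ### Affine coordinates at a vertex of a convex polygon. -/

theorem exists_coordinates {e f : Plane} (h : LinearIndependent ℝ ![e, f]) (q : Plane) :
    ∃ a b : ℝ, q = a • e + b • f := by
  have hs := h.span_eq_top_of_card_eq_finrank (by simp)
  rw [Matrix.range_cons_cons_empty] at hs
  have hq : q ∈ Submodule.span ℝ {e, f} := hs ▸ Submodule.mem_top
  obtain ⟨a, b, hab⟩ := Submodule.mem_span_pair.1 hq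
  exact ⟨a, b, hab.symm⟩

/-- A convex set whose frontier contains the midpoint of a segment lies on one side of it. -/
theorem nonneg_of_midpoint_mem_frontier {C : Set Plane} (hC : Convex ℝ C) {v e f : Plane}
    (hef : LinearIndependent ℝ ![e, f]) (hv : v ∈ C) (he : v + e ∈ C) (hf : v + f ∈ C)
    (hmid : v + (1 / 2 : ℝ) • e ∈ frontier C) {a b : ℝ} (hq : v + a • e + b • f ∈ C) : 0 ≤ b := by
  have hint : (interior C).Nonempty := by
    have hsub : convexHull ℝ {v, v + e, v + f} ⊆ C :=
      convexHull_min (by rintro _ (rfl | rfl | rfl) <;> assumption) hC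
    refine Set.Nonempty.mono (interior_mono hsub) ?_
    rw [interior_convexHull_nonempty_iff_affineSpan_eq_top,
      AffineSubspace.affineSpan_eq_top_iff_vectorSpan_eq_top_of_nonempty ℝ Plane Plane ⟨v, by simp⟩,
      eq_top_iff]
    rintro q -
    obtain ⟨a, b, rfl⟩ := exists_coordinates hef q
    have h1 := vsub_mem_vectorSpan ℝ (s := {v, v + e, v + f}) (p₁ := v + e) (p₂ := v)
      (by simp) (by simp)
    have h2 := vsub_mem_vectorSpan ℝ (s := {v, v + e, v + f}) (p₁ := v + f) (p₂ := v)
      (by simp) (by simp)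
    simp only [vsub_eq_sub, add_sub_cancel_left] at h1 h2
    exact add_mem (Submodule.smul_mem _ _ h1) (Submodule.smul_mem _ _ h2)
  obtain ⟨g, hg⟩ := geometric_hahn_banach_open_point hC.interior isOpen_interior hmid.2
  have hle : ∀ z ∈ C, g z ≤ g (v + (1 / 2 : ℝ) • e) := by
    intro z hz
    have hz' : z ∈ closure (interior C) := by
      rw [hC.closure_interior_eq_closure_of_nonempty_interior hint]
      exact subset_closure hz
    exact closure_minimal (fun w hw => (hg w hw).le)
      (isClosed_le g.continuous continuous_const) hz'
  have h1 := hle v hv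
  have h2 := hle _ he
  have h3 := hle _ hf
  have h4 := hle _ hq
  simp only [map_add, map_smul, smul_eq_mul] at h1 h2 h3 h4
  -- The supporting functional is maximal at the midpoint of `v` and `v + e`, so it is constant
  -- along that segment. If `g f` vanished too, `g` would be constant, against strictness on the
  -- interior.
  have hge : g e = 0 := by linarith
  have hgf : g f < 0 := by
    obtain ⟨z, hz⟩ := hint
    have hzlt := hg z hz
    refine lt_of_le_of_ne (by linarith) fun h0 => ?_
    obtain ⟨a', b', hab⟩ := exists_coordinates hef (z - v)
    have := congrArg g hab
    simp only [map_add, map_sub, map_smul, smul_eq_mul, hge, h0, mul_zero, add_zero] at this hzlt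
    linarith
  rw [hge] at h4
  by_contra hb
  nlinarith [mul_pos_of_neg_of_neg (not_le.1 hb) hgf]

namespace Polygon

variable {M : ℕ} {p : Polygon Plane M}

theorem vertex_mem_region (p : Polygon Plane M) (i : Fin M) : p i ∈ p.region :=
  subset_convexHull ℝ _ (Set.mem_range_self i)

theorem convex_region (p : Polygon Plane M) : Convex ℝ p.region := convex_convexHull ℝ _

theorem isCompact_region (p : Polygon Plane M) : IsCompact p.region :=
  (Set.finite_range _).isCompact_convexHull ℝ

namespace IsConvex

theorem mem_of_mem_convexHull (hp : p.IsConvex) {i : Fin M} {T : Set Plane}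
    (hT : T ⊆ p.region) (hi : p i ∈ convexHull ℝ T) : p i ∈ T := by
  have hext : p i ∈ p.region.extremePoints ℝ := by
    rw [hp.extremePoints_eq]
    exact Set.mem_range_self i
  exact extremePoints_convexHull_subset (inter_extremePoints_subset_extremePoints_of_subset
    (convexHull_min hT p.convex_region) ⟨hi, hext⟩)

theorem eq_or_eq_of_mem_segment (hp : p.IsConvex) {i j k : Fin M}
    (hi : p i ∈ segment ℝ (p j) (p k)) : i = j ∨ i = k := by
  rw [← convexHull_pair] at hi
  have := hp.mem_of_mem_convexHull (by
    rintro _ (rfl | rfl) <;> exact p.vertex_mem_region _) hi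
  rcases this with h | h
  · exact Or.inl (hp.injective h)
  · exact Or.inr (hp.injective h)

/-- Of three collinear points one lies between the other two, which is impossible for extreme
points. The ranges `a < 0`, `0 ≤ a ≤ 1` and `1 < a` decide which one. -/
theorem linearIndependent_sub (hp : p.IsConvex) {i j k : Fin M} (hij : i ≠ j) (hik : i ≠ k)
    (hjk : j ≠ k) : LinearIndependent ℝ ![p j - p i, p k - p i] := by
  rw [LinearIndependent.pair_iff' (sub_ne_zero.2 fun h => hij (hp.injective h).symm)]
  intro a ha
  have hk : p k = p i + a • (p j - p i) := by rw [ha]; abel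
  rcases lt_or_ge a 0 with h0 | h0
  · have : p i ∈ segment ℝ (p j) (p k) := by
      have h1 : 0 < 1 - a := by linarith
      refine ⟨-a / (1 - a), 1 / (1 - a), div_nonneg (by linarith) h1.le, by positivity,
        by field_simp; ring, ?_⟩
      rw [hk]
      match_scalars <;> (field_simp; ring)
    rcases hp.eq_or_eq_of_mem_segment this with h | h
    · exact hij h
    · exact hik h
  · rcases le_or_gt a 1 with h1 | h1
    · have : p k ∈ segment ℝ (p i) (p j) := by
        refine ⟨1 - a, a, by linarith, h0, by ring, ?_⟩
        rw [hk]
        module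
      rcases hp.eq_or_eq_of_mem_segment this with h | h
      · exact hik h.symm
      · exact hjk h.symm
    · have : p j ∈ segment ℝ (p i) (p k) := by
        refine ⟨1 - 1 / a, 1 / a, ?_, by positivity, by ring, ?_⟩
        · rw [sub_nonneg, div_le_one (by linarith)]
          exact h1.le
        · rw [hk]
          match_scalars <;> field_simp <;> ring
      rcases hp.eq_or_eq_of_mem_segment this with h | h
      · exact hij h.symm
      · exact hjk h

/-- Two vertices with the midpoint of their segment on the frontier, and a third vertex: the region
lies on the side of the third vertex. -/
theorem nonneg_of_midpoint (hp : p.IsConvex) {i j k : Fin M} (hij : i ≠ j) (hik : i ≠ k)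
    (hjk : j ≠ k) (hmid : midpoint ℝ (p i) (p j) ∈ frontier p.region) {a b : ℝ}
    (hq : p i + a • (p j - p i) + b • (p k - p i) ∈ p.region) : 0 ≤ b := by
  refine nonneg_of_midpoint_mem_frontier p.convex_region (hp.linearIndependent_sub hij hik hjk)
    (p.vertex_mem_region i) ?_ ?_ ?_ hq
  · simpa using p.vertex_mem_region j
  · simpa using p.vertex_mem_region k
  · convert! hmid using 1
    rw [midpoint_eq_smul_add]
    simp only [invOf_eq_inv]
    module

theorem finRotate_ne (hM : 3 ≤ M) (i : Fin M) : i ≠ finRotate M i := by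
  obtain ⟨m, rfl⟩ : ∃ m, M = m + 3 := ⟨M - 3, by omega⟩
  intro h
  have := congrArg Fin.val h
  rw [coe_finRotate] at this
  split_ifs at this with hi
  · subst hi; simp at this
  · omega

theorem finRotate_finRotate_ne (hM : 3 ≤ M) (i : Fin M) : finRotate M (finRotate M i) ≠ i := by
  obtain ⟨m, rfl⟩ : ∃ m, M = m + 3 := ⟨M - 3, by omega⟩
  rw [finRotate_apply, finRotate_apply, add_assoc, Ne, add_eq_left, Fin.ext_iff]
  simp [Fin.val_add, Nat.mod_eq_of_lt]

theorem ne_finRotate_symm (hM : 3 ≤ M) (i : Fin M) : i ≠ (finRotate M).symm i := fun h =>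
  finRotate_ne hM i (by conv_rhs => rw [h, Equiv.apply_symm_apply])

theorem finRotate_ne_finRotate_symm (hM : 3 ≤ M) (i : Fin M) :
    finRotate M i ≠ (finRotate M).symm i := fun h =>
  finRotate_finRotate_ne hM i (by rw [h, Equiv.apply_symm_apply])

theorem segment_subset_frontier (hp : p.IsConvex) (i : Fin M) :
    segment ℝ (p i) (p (finRotate M i)) ⊆ frontier p.region := by
  rw [hp.frontier_eq, ← affineSegment_eq_segment]
  exact Set.subset_iUnion (fun i => p.edgeSet ℝ i) i

theorem mem_frontier_iff (hp : p.IsConvex) {z : Plane} :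
    z ∈ frontier p.region ↔ ∃ i, z ∈ segment ℝ (p i) (p (finRotate M i)) := by
  rw [hp.frontier_eq, Polygon.boundary, Set.mem_iUnion]
  simp only [Polygon.edgeSet, affineSegment_eq_segment]

/-- The region lies in the cone that the two edges at a vertex span. -/
theorem exists_cone_coordinates (hM : 3 ≤ M) (hp : p.IsConvex) (i : Fin M) {q : Plane}
    (hq : q ∈ p.region) : ∃ a b : ℝ, 0 ≤ a ∧ 0 ≤ b ∧
      q = p i + a • (p (finRotate M i) - p i) + b • (p ((finRotate M).symm i) - p i) := by
  have h1 := finRotate_ne hM i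
  have h2 := ne_finRotate_symm hM i
  have h3 := finRotate_ne_finRotate_symm hM i
  obtain ⟨a, b, hab⟩ := exists_coordinates (hp.linearIndependent_sub h1 h2 h3) (q - p i)
  have hqe : q = p i + a • (p (finRotate M i) - p i) + b • (p ((finRotate M).symm i) - p i) := by
    rw [add_assoc, ← hab]; abel
  refine ⟨a, b, ?_, ?_, hqe⟩
  · refine hp.nonneg_of_midpoint h2 h1 h3.symm ?_ (a := b) ?_
    · rw [midpoint_comm]
      have := hp.segment_subset_frontier ((finRotate M).symm i)
      rw [Equiv.apply_symm_apply] at this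
      exact this (midpoint_mem_segment _ _)
    · rw [add_right_comm, ← hqe]; exact hq
  · exact hp.nonneg_of_midpoint h1 h2 h3
      (hp.segment_subset_frontier i (midpoint_mem_segment _ _)) (hqe ▸ hq)

/-- All other vertices lie beyond the line through the two neighbours of a vertex. -/
theorem exists_vertex_coordinates (hM : 3 ≤ M) (hp : p.IsConvex) {i j : Fin M} (hij : j ≠ i) :
    ∃ a b : ℝ, 0 ≤ a ∧ 0 ≤ b ∧ 1 ≤ a + b ∧
      p j = p i + a • (p (finRotate M i) - p i) + b • (p ((finRotate M).symm i) - p i) := by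
  obtain ⟨a, b, ha, hb, hab⟩ := hp.exists_cone_coordinates hM i (p.vertex_mem_region j)
  by_cases hj1 : j = finRotate M i
  · exact ⟨1, 0, zero_le_one, le_rfl, by norm_num, by rw [hj1]; module⟩
  by_cases hj2 : j = (finRotate M).symm i
  · exact ⟨0, 1, le_rfl, zero_le_one, by norm_num, by rw [hj2]; module⟩
  refine ⟨a, b, ha, hb, ?_, hab⟩
  by_contra! hlt
  -- With `a + b < 1` the vertex would lie in the triangle of three other vertices, against
  -- extremality.
  have hmem : p j ∈ convexHull ℝ {p i, p (finRotate M i), p ((finRotate M).symm i)} := by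
    have hc := convex_convexHull ℝ {p i, p (finRotate M i), p ((finRotate M).symm i)}
    have hs := subset_convexHull ℝ {p i, p (finRotate M i), p ((finRotate M).symm i)}
    have := hc.sum_mem (t := Finset.univ) (w := ![1 - a - b, a, b])
      (z := ![p i, p (finRotate M i), p ((finRotate M).symm i)])
      (by intro k _; fin_cases k <;> simp <;> linarith) (by simp [Fin.sum_univ_three]; ring)
      (by intro k _; fin_cases k <;> exact hs (by simp))
    convert! this using 1
    rw [hab]
    simp only [Fin.sum_univ_three, Matrix.cons_val_zero, Matrix.cons_val_one, Matrix.cons_val]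
    module
  have := hp.mem_of_mem_convexHull (by
    rintro _ (rfl | rfl | rfl) <;> exact p.vertex_mem_region _) hmem
  rcases this with h | h | h
  · exact hij (hp.injective h)
  · exact hj1 (hp.injective h)
  · exact hj2 (hp.injective h)

/-- The vertices off an edge lie strictly on one side of it. -/
theorem exists_vertex_coordinates_pos (hM : 3 ≤ M) (hp : p.IsConvex) {i j : Fin M} (hij : j ≠ i)
    (hj : j ≠ finRotate M i) : ∃ a b : ℝ, 0 < b ∧
      p j = p i + a • (p (finRotate M i) - p i) + b • (p ((finRotate M).symm i) - p i) := by
  obtain ⟨a, b, ha, hb, hab, hpj⟩ := hp.exists_vertex_coordinates hM hij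
  refine ⟨a, b, hb.lt_of_ne fun h0 => ?_, hpj⟩
  subst h0
  have ha1 : 1 ≤ a := by linarith
  have : p (finRotate M i) ∈ segment ℝ (p i) (p j) := by
    refine ⟨1 - 1 / a, 1 / a, ?_, by positivity, by ring, ?_⟩
    · rw [sub_nonneg, div_le_one (by linarith)]
      exact ha1
    · rw [hpj]
      match_scalars <;> field_simp <;> ring
  rcases hp.eq_or_eq_of_mem_segment this with h | h
  · exact finRotate_ne hM i h.symm
  · exact hj h.symm

/-- An edge avoiding the vertex `i` has both ends beyond the line through the two neighbours of `i`;
these conditions are preserved by convex combinations. -/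
theorem frontier_coordinates (hM : 3 ≤ M) (hp : p.IsConvex) (i : Fin M) {z : Plane}
    (hz : z ∈ frontier p.region) :
    z ∈ segment ℝ (p i) (p (finRotate M i)) ∨ z ∈ segment ℝ (p i) (p ((finRotate M).symm i)) ∨
    ∃ a b : ℝ, 0 ≤ a ∧ 0 ≤ b ∧ 1 ≤ a + b ∧
      z = p i + a • (p (finRotate M i) - p i) + b • (p ((finRotate M).symm i) - p i) := by
  obtain ⟨k, hk⟩ := hp.mem_frontier_iff.1 hz
  by_cases h1 : k = i
  · exact Or.inl (h1 ▸ hk)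
  by_cases h2 : finRotate M k = i
  · right; left
    rw [segment_symm, ← h2, Equiv.symm_apply_apply]
    exact hk
  right; right
  obtain ⟨a, b, ha, hb, hab, h⟩ := hp.exists_vertex_coordinates hM h1
  obtain ⟨a', b', ha', hb', hab', h'⟩ := hp.exists_vertex_coordinates hM h2
  obtain ⟨l, m, hl, hm, hlm, rfl⟩ := hk
  refine ⟨l * a + m * a', l * b + m * b', by positivity, by positivity, ?_, ?_⟩
  · nlinarith
  · rw [h, h']
    have : p i = l • p i + m • p i := by rw [← add_smul, hlm, one_smul]
    match_scalars <;> linarith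

/-- The coordinate transverse to edge `i` is nonnegative at both ends of edge `k` and positive at
one of them, so it can vanish only at the other end. -/
theorem subsingleton_inter_edges (hM : 3 ≤ M) (hp : p.IsConvex) {i k : Fin M} (hik : i ≠ k) :
    (segment ℝ (p i) (p (finRotate M i)) ∩ segment ℝ (p k) (p (finRotate M k))).Subsingleton := by
  have hind := hp.linearIndependent_sub (finRotate_ne hM i) (ne_finRotate_symm hM i)
    (finRotate_ne_finRotate_symm hM i)
  set e := p (finRotate M i) - p i
  set f := p ((finRotate M).symm i) - p i
  have hcoord : ∀ j, ∃ a b : ℝ, 0 ≤ b ∧ (j ≠ i → j ≠ finRotate M i → 0 < b) ∧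
      p j = p i + a • e + b • f := by
    intro j
    by_cases h1 : j = i
    · exact ⟨0, 0, le_rfl, fun h => absurd h1 h, by rw [h1]; module⟩
    by_cases h2 : j = finRotate M i
    · exact ⟨1, 0, le_rfl, fun _ h => absurd h2 h, by rw [h2]; module⟩
    obtain ⟨a, b, hb, h⟩ := hp.exists_vertex_coordinates_pos hM h1 h2
    exact ⟨a, b, hb.le, fun _ _ => hb, h⟩
  obtain ⟨a, b, hb0, hb, hk⟩ := hcoord k
  obtain ⟨a', b', hb0', hb', hk'⟩ := hcoord (finRotate M k)
  have hpos : 0 < b + b' := by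
    by_cases h : k = finRotate M i
    · have := hb' (by rw [h]; exact finRotate_finRotate_ne hM i)
        (by rw [← h]; exact (finRotate_ne hM k).symm)
      linarith
    · have := hb hik.symm h
      linarith
  have hzero : ∀ z ∈ segment ℝ (p i) (p (finRotate M i)), ∀ l m : ℝ, l + m = 1 →
      l • p k + m • p (finRotate M k) = z → l * b + m * b' = 0 := by
    rintro z ⟨s, t, -, -, hst, rfl⟩ l m hlm hz
    refine (LinearIndependent.pair_iff.1 hind (l * a + m * a' - t) (l * b + m * b') ?_).2
    have h1 : s • p i + t • p (finRotate M i) = p i + t • e := by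
      rw [← eq_sub_iff_add_eq] at hst
      rw [hst]
      simp only [e]
      module
    have h2 : p i = l • p i + m • p i := by rw [← add_smul, hlm, one_smul]
    rw [h1, hk, hk', ← sub_eq_zero] at hz
    nth_rewrite 3 [h2] at hz
    rw [← hz]
    module
  have hunique : ∀ z ∈ segment ℝ (p i) (p (finRotate M i)) ∩ segment ℝ (p k) (p (finRotate M k)),
      z = if 0 < b then p (finRotate M k) else p k := by
    rintro z ⟨hz, ⟨l, m, hl, hm, hlm, hlz⟩⟩
    have h0 := hzero z hz l m hlm hlz
    have h1 : 0 ≤ l * b := by positivity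
    have h2 : 0 ≤ m * b' := by positivity
    split_ifs with hbpos
    · have : l = 0 := by
        rcases mul_eq_zero.1 (by linarith : l * b = 0) with h | h
        · exact h
        · exact absurd h hbpos.ne'
      subst this
      rw [zero_add] at hlm
      rw [← hlz, hlm, zero_smul, one_smul, zero_add]
    · have hb'pos : 0 < b' := by linarith [not_lt.1 hbpos]
      have : m = 0 := by
        rcases mul_eq_zero.1 (by linarith : m * b' = 0) with h | h
        · exact h
        · exact absurd h hb'pos.ne'
      subst this
      rw [add_zero] at hlm
      rw [← hlz, hlm, zero_smul, one_smul, add_zero]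
  intro z hz z' hz'
  rw [hunique z hz, hunique z' hz']

end IsConvex

end Polygon

/-! ### Arc length on the boundary and gaps at the edge ends. -/

namespace Polygon

variable {M : ℕ}

/-- The other end of the edge that leaves the vertex `k.1` forwards (`true`) or backwards
(`false`). -/
def neighbor (k : Fin M × Bool) : Fin M :=
  if k.2 then finRotate M k.1 else (finRotate M).symm k.1

/-- The first end, in cyclic order, of the edge that leaves the vertex `k.1` in direction `k.2`. -/
def edgeIndex (k : Fin M × Bool) : Fin M :=
  if k.2 then k.1 else (finRotate M).symm k.1

/-- The edge that leaves the vertex `k.1` in direction `k.2`. -/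
def side (p : Polygon Plane M) (k : Fin M × Bool) : Set Plane :=
  segment ℝ (p k.1) (p (neighbor k))

noncomputable def sideLength (p : Polygon Plane M) (k : Fin M × Bool) : ℝ :=
  dist (p k.1) (p (neighbor k))

/-- The unit vector from the vertex `k.1` along its edge in direction `k.2`. -/
noncomputable def sideDir (p : Polygon Plane M) (k : Fin M × Bool) : Plane :=
  (p.sideLength k)⁻¹ • (p (neighbor k) - p k.1)

open Classical in
/-- The distance from the vertex `k.1` to a point of its edge in direction `k.2`, with a larger
default value off this edge. -/
noncomputable def gap (p : Polygon Plane M) (k : Fin M × Bool) (z : Plane) : ℝ :=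
  if z ∈ p.side k then dist z (p k.1) else p.sideLength k + 1

variable {p : Polygon Plane M}

theorem side_eq_edge (p : Polygon Plane M) (k : Fin M × Bool) :
    p.side k = segment ℝ (p (edgeIndex k)) (p (finRotate M (edgeIndex k))) := by
  obtain ⟨i, _ | _⟩ := k
  · simp only [side, neighbor, edgeIndex, Bool.false_eq_true, if_false, Equiv.apply_symm_apply]
    exact segment_symm ℝ _ _
  · simp [side, neighbor, edgeIndex]

theorem neighbor_eq_of_edgeIndex_eq {k k' : Fin M × Bool} (hk : k ≠ k')
    (h : edgeIndex k = edgeIndex k') : neighbor k = k'.1 := by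
  obtain ⟨i, _ | _⟩ := k <;> obtain ⟨i', _ | _⟩ := k' <;>
    simp only [edgeIndex, neighbor, Bool.false_eq_true, if_false, if_true,
      EmbeddingLike.apply_eq_iff_eq] at h ⊢
  · exact absurd (by rw [h]) hk
  · exact h
  · rw [h, Equiv.apply_symm_apply]
  · exact absurd (by rw [h]) hk

theorem isClosed_side (p : Polygon Plane M) (k : Fin M × Bool) : IsClosed (p.side k) := by
  rw [side, ← convexHull_pair]
  exact ((Set.toFinite _).isCompact_convexHull ℝ).isClosed

theorem measurable_gap (p : Polygon Plane M) (k : Fin M × Bool) : Measurable (p.gap k) := by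
  classical
  exact Measurable.ite (p.isClosed_side k).measurableSet (by fun_prop) measurable_const

theorem gap_nonneg (p : Polygon Plane M) (k : Fin M × Bool) (z : Plane) : 0 ≤ p.gap k z := by
  unfold gap
  split_ifs
  · exact dist_nonneg
  · unfold sideLength; positivity

namespace IsConvex

theorem ne_neighbor (hM : 3 ≤ M) (k : Fin M × Bool) : k.1 ≠ neighbor k := by
  obtain ⟨i, _ | _⟩ := k
  · exact ne_finRotate_symm hM i
  · exact finRotate_ne hM i

theorem sideLength_pos (hM : 3 ≤ M) (hp : p.IsConvex) (k : Fin M × Bool) : 0 < p.sideLength k :=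
  dist_pos.2 fun h => ne_neighbor hM k (hp.injective h)

theorem norm_sideDir (hM : 3 ≤ M) (hp : p.IsConvex) (k : Fin M × Bool) : ‖p.sideDir k‖ = 1 := by
  have := hp.sideLength_pos hM k
  rw [sideDir, norm_smul, ← dist_eq_norm, dist_comm, norm_inv, Real.norm_of_nonneg this.le]
  exact inv_mul_cancel₀ this.ne'

theorem sideLength_smul_sideDir (hM : 3 ≤ M) (hp : p.IsConvex) (k : Fin M × Bool) :
    p.sideLength k • p.sideDir k = p (neighbor k) - p k.1 :=
  smul_inv_smul₀ (hp.sideLength_pos hM k).ne' _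

theorem mem_side_iff (hM : 3 ≤ M) (hp : p.IsConvex) {k : Fin M × Bool} {z : Plane} :
    z ∈ p.side k ↔ ∃ r, 0 ≤ r ∧ r ≤ p.sideLength k ∧ z = p k.1 + r • p.sideDir k := by
  have hpos := hp.sideLength_pos hM k
  rw [side, segment_eq_image']
  constructor
  · rintro ⟨θ, ⟨h0, h1⟩, rfl⟩
    refine ⟨θ * p.sideLength k, by positivity, mul_le_of_le_one_left hpos.le h1, ?_⟩
    rw [mul_smul, hp.sideLength_smul_sideDir hM]
  · rintro ⟨r, h0, h1, rfl⟩
    refine ⟨r / p.sideLength k, ⟨by positivity, (div_le_one hpos).2 h1⟩, ?_⟩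
    simp only [sideDir, smul_smul, div_eq_mul_inv]

theorem gap_add_smul_sideDir (hM : 3 ≤ M) (hp : p.IsConvex) {k : Fin M × Bool} {r : ℝ}
    (h0 : 0 ≤ r) (h1 : r ≤ p.sideLength k) : p.gap k (p k.1 + r • p.sideDir k) = r := by
  rw [gap, if_pos ((hp.mem_side_iff hM).2 ⟨r, h0, h1, rfl⟩), dist_eq_norm, add_sub_cancel_left,
    norm_smul, hp.norm_sideDir hM, Real.norm_of_nonneg h0, mul_one]

theorem gap_le_iff (hM : 3 ≤ M) (hp : p.IsConvex) {k : Fin M × Bool} {s : ℝ}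
    (hs : s ≤ p.sideLength k) {z : Plane} :
    p.gap k z ≤ s ↔ ∃ r, 0 ≤ r ∧ r ≤ s ∧ z = p k.1 + r • p.sideDir k := by
  constructor
  · intro h
    -- Off the side the default value exceeds `p.sideLength k`, hence exceeds `s`.
    have hz : z ∈ p.side k := by
      by_contra hz
      rw [gap, if_neg hz] at h
      linarith
    obtain ⟨r, h0, h1, rfl⟩ := (hp.mem_side_iff hM).1 hz
    rw [hp.gap_add_smul_sideDir hM h0 h1] at h
    exact ⟨r, h0, h, rfl⟩
  · rintro ⟨r, h0, h1, rfl⟩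
    rwa [hp.gap_add_smul_sideDir hM h0 (h1.trans hs)]

theorem side_subset_frontier (hp : p.IsConvex) (k : Fin M × Bool) :
    p.side k ⊆ frontier p.region := by
  rw [side_eq_edge]
  exact hp.segment_subset_frontier _

theorem gap_le_subset_side (hM : 3 ≤ M) (hp : p.IsConvex) {k : Fin M × Bool} {s : ℝ}
    (hs : s ≤ p.sideLength k) : {z | p.gap k z ≤ s} ⊆ p.side k := by
  intro z hz
  obtain ⟨r, h0, h1, rfl⟩ := (hp.gap_le_iff hM hs).1 hz
  exact (hp.mem_side_iff hM).2 ⟨r, h0, h1.trans hs, rfl⟩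

theorem hausdorffMeasure_gap_le (hM : 3 ≤ M) (hp : p.IsConvex) {k : Fin M × Bool} {s : ℝ}
    (hs : s ≤ p.sideLength k) :
    (Measure.hausdorffMeasure 1 : Measure Plane) {z | p.gap k z ≤ s} = ENNReal.ofReal s := by
  rcases lt_or_ge s 0 with h | h
  · have : {z | p.gap k z ≤ s} = ∅ :=
      Set.eq_empty_of_forall_notMem fun z hz => (h.trans_le (p.gap_nonneg k z)).not_ge hz
    rw [this, measure_empty, ENNReal.ofReal_of_nonpos h.le]
  · have : {z | p.gap k z ≤ s} = segment ℝ (p k.1) (p k.1 + s • p.sideDir k) := by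
      ext z
      rw [Set.mem_ofPred_eq, hp.gap_le_iff hM hs, segment_eq_image']
      constructor
      · rintro ⟨r, h0, h1, rfl⟩
        rcases h.eq_or_lt with rfl | hpos
        · exact ⟨0, by simp, by simp [le_antisymm h1 h0]⟩
        · refine ⟨r / s, ⟨by positivity, (div_le_one hpos).2 h1⟩, ?_⟩
          simp only [add_sub_cancel_left, smul_smul]
          rw [div_mul_cancel₀ _ hpos.ne']
      · rintro ⟨θ, ⟨h0, h1⟩, rfl⟩
        exact ⟨θ * s, by positivity, mul_le_of_le_one_left h h1, by
          simp only [add_sub_cancel_left, smul_smul]⟩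
    rw [this, hausdorffMeasure_segment, edist_dist, dist_self_add_right, norm_smul,
      hp.norm_sideDir hM, mul_one, Real.norm_of_nonneg h]

theorem aedisjoint_edges (hM : 3 ≤ M) (hp : p.IsConvex) {i k : Fin M} (hik : i ≠ k) :
    AEDisjoint (Measure.hausdorffMeasure 1 : Measure Plane)
      (segment ℝ (p i) (p (finRotate M i))) (segment ℝ (p k) (p (finRotate M k))) := by
  have := Measure.nullSingletonClass_hausdorff Plane (d := 1) one_pos
  exact (hp.subsingleton_inter_edges hM hik).measure_zero _

theorem hausdorffMeasure_frontier (hM : 3 ≤ M) (hp : p.IsConvex) :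
    (Measure.hausdorffMeasure 1 : Measure Plane) (frontier p.region) =
      ENNReal.ofReal p.perimeter := by
  have : frontier p.region = ⋃ i, segment ℝ (p i) (p (finRotate M i)) := by
    ext z; rw [hp.mem_frontier_iff, Set.mem_iUnion]
  rw [this, measure_iUnion₀ (fun i k hik => hp.aedisjoint_edges hM hik) fun i => ?_]
  · rw [tsum_fintype, perimeter, ENNReal.ofReal_sum_of_nonneg fun i _ => dist_nonneg]
    simp only [hausdorffMeasure_segment, edist_dist]
  · exact (p.isClosed_side (i, true)).measurableSet.nullMeasurableSet

theorem perimeter_pos (hM : 3 ≤ M) (hp : p.IsConvex) : 0 < p.perimeter := by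
  have : NeZero M := ⟨by omega⟩
  exact Finset.sum_pos (fun i _ => hp.sideLength_pos hM (i, true)) Finset.univ_nonempty

/-- Each edge occurs twice, once from each end; pieces shorter than half of it cannot meet. Pieces
of different edges share at most one point. -/
theorem aedisjoint_gap_le (hM : 3 ≤ M) (hp : p.IsConvex) {s : Fin M × Bool → ℝ}
    (hs : ∀ k, s k < p.sideLength k / 2) {k k' : Fin M × Bool} (hk : k ≠ k') :
    AEDisjoint (Measure.hausdorffMeasure 1 : Measure Plane)
      {z | p.gap k z ≤ s k} {z | p.gap k' z ≤ s k'} := by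
  have hs' : ∀ k, s k ≤ p.sideLength k := fun k => by
    linarith [hs k, hp.sideLength_pos hM k]
  by_cases he : edgeIndex k = edgeIndex k'
  · refine Disjoint.aedisjoint (Set.disjoint_left.2 fun z hz hz' => ?_)
    have h1 := hp.gap_le_subset_side hM (hs' k) hz
    have h2 := hp.gap_le_subset_side hM (hs' k') hz'
    rw [Set.mem_ofPred_eq, gap, if_pos h1] at hz
    rw [Set.mem_ofPred_eq, gap, if_pos h2] at hz'
    have hn := And.intro (neighbor_eq_of_edgeIndex_eq hk he)
      (neighbor_eq_of_edgeIndex_eq hk.symm he.symm)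
    have h3 := hs k
    have h4 := hs k'
    rw [sideLength, hn.1] at h3
    rw [sideLength, hn.2, dist_comm] at h4
    linarith [dist_triangle_left (p k.1) (p k'.1) z]
  · have := hp.aedisjoint_edges hM he
    rw [← side_eq_edge, ← side_eq_edge] at this
    exact this.mono (hp.gap_le_subset_side hM (hs' k)) (hp.gap_le_subset_side hM (hs' k'))

end IsConvex

/-- The uniform distribution on the boundary of the polygon. -/
noncomputable def uniformBoundary (p : Polygon Plane M) : Measure Plane :=
  ProbabilityTheory.cond (Measure.hausdorffMeasure 1) (frontier p.region)

namespace IsConvex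

theorem hausdorffMeasure_frontier_ne_zero (hM : 3 ≤ M) (hp : p.IsConvex) :
    (Measure.hausdorffMeasure 1 : Measure Plane) (frontier p.region) ≠ 0 := by
  rw [hp.hausdorffMeasure_frontier hM]
  simpa using hp.perimeter_pos hM

theorem hausdorffMeasure_frontier_ne_top (hM : 3 ≤ M) (hp : p.IsConvex) :
    (Measure.hausdorffMeasure 1 : Measure Plane) (frontier p.region) ≠ ⊤ := by
  rw [hp.hausdorffMeasure_frontier hM]
  exact ENNReal.ofReal_ne_top

theorem isProbabilityMeasure_uniformBoundary (hM : 3 ≤ M) (hp : p.IsConvex) :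
    IsProbabilityMeasure p.uniformBoundary :=
  cond_isProbabilityMeasure_of_finite (hp.hausdorffMeasure_frontier_ne_zero hM)
    (hp.hausdorffMeasure_frontier_ne_top hM)

theorem measureReal_uniformBoundary (hM : 3 ≤ M) (hp : p.IsConvex) {s : Set Plane}
    (hs : s ⊆ frontier p.region) : p.uniformBoundary.real s =
      (Measure.hausdorffMeasure 1 : Measure Plane).real s / p.perimeter := by
  rw [uniformBoundary, measureReal_def, cond_apply isClosed_frontier.measurableSet,
    Set.inter_eq_self_of_subset_right hs, hp.hausdorffMeasure_frontier hM, ENNReal.toReal_mul,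
    ENNReal.toReal_inv, ENNReal.toReal_ofReal (hp.perimeter_pos hM).le, div_eq_inv_mul,
    measureReal_def]

theorem ae_uniformBoundary_mem (p : Polygon Plane M) :
    ∀ᵐ z ∂p.uniformBoundary, z ∈ frontier p.region :=
  ae_cond_mem isClosed_frontier.measurableSet

theorem measureReal_gap_le (hM : 3 ≤ M) (hp : p.IsConvex) {k : Fin M × Bool} {s : ℝ}
    (h0 : 0 ≤ s) (hs : s ≤ p.sideLength k) :
    p.uniformBoundary.real {z | p.gap k z ≤ s} = s / p.perimeter := by
  rw [hp.measureReal_uniformBoundary hM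
    ((hp.gap_le_subset_side hM hs).trans (hp.side_subset_frontier k)), measureReal_def,
    hp.hausdorffMeasure_gap_le hM hs, ENNReal.toReal_ofReal h0]

theorem measureReal_lt_gap (hM : 3 ≤ M) (hp : p.IsConvex) {k : Fin M × Bool} {s : ℝ}
    (h0 : 0 ≤ s) (hs : s ≤ p.sideLength k) :
    p.uniformBoundary.real {z | s < p.gap k z} = 1 - s / p.perimeter := by
  have := hp.isProbabilityMeasure_uniformBoundary hM
  rw [← hp.measureReal_gap_le hM h0 hs,
    ← probReal_compl_eq_one_sub (measurableSet_le (p.measurable_gap k) measurable_const)]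
  congr 1
  ext z
  simp

theorem measureReal_forall_lt_gap (hM : 3 ≤ M) (hp : p.IsConvex) {s : Fin M × Bool → ℝ}
    (hs : ∀ k, s k < p.sideLength k / 2) :
    p.uniformBoundary.real {z | ∀ k, s k < p.gap k z} =
      1 - (∑ k, max (s k) 0) / p.perimeter := by
  have := hp.isProbabilityMeasure_uniformBoundary hM
  have hs' : ∀ k, s k ≤ p.sideLength k := fun k => by
    linarith [hs k, hp.sideLength_pos hM k]
  have hmeas : ∀ k, MeasurableSet {z | p.gap k z ≤ s k} := fun k =>
    measurableSet_le (p.measurable_gap k) measurable_const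
  have hcompl : {z | ∀ k, s k < p.gap k z} = (⋃ k, {z | p.gap k z ≤ s k})ᶜ := by
    ext z; simp
  rw [hcompl, probReal_compl_eq_one_sub (MeasurableSet.iUnion hmeas),
    hp.measureReal_uniformBoundary hM (Set.iUnion_subset fun k =>
      (hp.gap_le_subset_side hM (hs' k)).trans (hp.side_subset_frontier k)), measureReal_def,
    measure_iUnion₀ (fun k k' hk => hp.aedisjoint_gap_le hM hs hk)
      fun k => (hmeas k).nullMeasurableSet, tsum_fintype]
  simp only [hp.hausdorffMeasure_gap_le hM (hs' _)]
  rw [ENNReal.toReal_sum fun _ _ => ENNReal.ofReal_ne_top]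
  simp only [ENNReal.toReal_ofReal']

end IsConvex

/-! ### Random samples and the limit law of their gaps. -/

/-- The law of `n` independent uniform points on the boundary. -/
noncomputable def sampleLaw (p : Polygon Plane M) (n : ℕ) : Measure (Fin n → Plane) :=
  Measure.pi fun _ => p.uniformBoundary

/-- The smallest gap of the sample points at each end of each edge. -/
noncomputable def sampleGap (p : Polygon Plane M) {n : ℕ} [NeZero n] (x : Fin n → Plane)
    (k : Fin M × Bool) : ℝ :=
  Finset.univ.inf' Finset.univ_nonempty fun j => p.gap k (x j)

theorem lt_sampleGap_iff {n : ℕ} [NeZero n] {x : Fin n → Plane} {k : Fin M × Bool} {s : ℝ} :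
    s < p.sampleGap x k ↔ ∀ j, s < p.gap k (x j) := by
  simp [sampleGap]

theorem sampleGap_le {n : ℕ} [NeZero n] (x : Fin n → Plane) (k : Fin M × Bool) (j : Fin n) :
    p.sampleGap x k ≤ p.gap k (x j) :=
  Finset.inf'_le (fun j => p.gap k (x j)) (Finset.mem_univ j)

theorem exists_sampleGap_eq {n : ℕ} [NeZero n] (x : Fin n → Plane) (k : Fin M × Bool) :
    ∃ j, p.sampleGap x k = p.gap k (x j) := by
  obtain ⟨j, -, hj⟩ := Finset.exists_mem_eq_inf' (Finset.univ_nonempty (α := Fin n))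
    fun j => p.gap k (x j)
  exact ⟨j, hj⟩

theorem measurable_sampleGap (p : Polygon Plane M) (n : ℕ) [NeZero n] :
    Measurable fun x : Fin n → Plane => p.sampleGap x := by
  refine measurable_pi_lambda _ fun k => measurable_of_Ioi fun s => ?_
  have : (fun x : Fin n → Plane => p.sampleGap x k) ⁻¹' Set.Ioi s =
      ⋂ j, {x | s < p.gap k (x j)} := by
    ext x; simp [lt_sampleGap_iff]
  rw [this]
  exact MeasurableSet.iInter fun j => measurableSet_lt measurable_const
    ((p.measurable_gap k).comp (measurable_pi_apply j))

theorem measureReal_sampleLaw_forall (hM : 3 ≤ M) (hp : p.IsConvex) (n : ℕ) (s : Set Plane) :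
    (p.sampleLaw n).real {x | ∀ j, x j ∈ s} = p.uniformBoundary.real s ^ n := by
  have := hp.isProbabilityMeasure_uniformBoundary hM
  have hs : {x : Fin n → Plane | ∀ j, x j ∈ s} = Set.univ.pi fun _ => s := by ext; simp
  rw [hs, sampleLaw, measureReal_def, Measure.pi_pi, Finset.prod_const, Finset.card_univ,
    Fintype.card_fin, ENNReal.toReal_pow, measureReal_def]

theorem IsConvex.isProbabilityMeasure_sampleLaw (hM : 3 ≤ M) (hp : p.IsConvex) (n : ℕ) :
    IsProbabilityMeasure (p.sampleLaw n) := by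
  have := hp.isProbabilityMeasure_uniformBoundary hM
  unfold sampleLaw
  infer_instance

theorem IsConvex.ae_sampleLaw_mem (hM : 3 ≤ M) (hp : p.IsConvex) (n : ℕ) :
    ∀ᵐ x ∂(p.sampleLaw n), ∀ j, x j ∈ frontier p.region := by
  have := hp.isProbabilityMeasure_uniformBoundary hM
  refine ae_all_iff.2 fun j => ?_
  exact (Measure.quasiMeasurePreserving_eval (fun _ : Fin n => p.uniformBoundary) j).ae
    (IsConvex.ae_uniformBoundary_mem p)

/-- The rescaled gaps converge in law to independent exponential variables. -/
theorem IsConvex.tendsto_sampleGap_upperOrthant (hM : 3 ≤ M) (hp : p.IsConvex)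
    (t : Fin M × Bool → ℝ) :
    Tendsto (fun n : ℕ => (p.sampleLaw (n + 1)).real
      {x | ∀ k, t k < (n + 1 : ℕ) * p.sampleGap x k}) atTop
      (𝓝 ((expPi (Fin M × Bool) p.perimeter⁻¹).real {y | ∀ k, t k < y k})) := by
  have hP := hp.perimeter_pos hM
  rw [measureReal_expPi_upperOrthant (inv_pos.2 hP)]
  have hlim := (Real.tendsto_one_add_div_pow_exp
    (-(p.perimeter⁻¹ * ∑ k, max (t k) 0))).comp (tendsto_add_atTop_nat 1)
  refine hlim.congr' ?_
  -- Below half the edge lengths the survival function of the gaps is given exactly, so the two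
  -- sequences agree eventually.
  have hsmall : ∀ᶠ n : ℕ in atTop, ∀ k, t k / (n + 1 : ℕ) < p.sideLength k / 2 := by
    refine eventually_all.2 fun k => ?_
    have h := (tendsto_const_div_atTop_nhds_zero_nat (t k)).comp (tendsto_add_atTop_nat 1)
    exact h.eventually_lt_const (half_pos (hp.sideLength_pos hM k))
  filter_upwards [hsmall] with n hn
  have hn0 : (0 : ℝ) < (n + 1 : ℕ) := by positivity
  have hset : {x : Fin (n + 1) → Plane | ∀ k, t k < (n + 1 : ℕ) * p.sampleGap x k} =
      {x | ∀ j, x j ∈ {z | ∀ k, t k / (n + 1 : ℕ) < p.gap k z}} := by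
    ext x
    simp only [Set.mem_ofPred_eq, ← div_lt_iff₀' hn0, lt_sampleGap_iff]
    exact forall_comm
  rw [hset, measureReal_sampleLaw_forall hM hp, hp.measureReal_forall_lt_gap hM hn,
    Function.comp_apply]
  congr 1
  have : ∀ k, max (t k / (n + 1 : ℕ)) 0 = max (t k) 0 / (n + 1 : ℕ) := fun k => by
    rw [← max_div_div_right hn0.le, zero_div]
  simp only [this]
  rw [← Finset.sum_div]
  field_simp
  ring

end Polygon

/-! ### The limit of the mean distance and its bounds. -/

namespace Polygon

variable {M : ℕ} {p : Polygon Plane M}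

/-- The largest distance of a vertex of the polygon from the hull of a sample. -/
noncomputable def maxVertexDist [NeZero M] (p : Polygon Plane M) {n : ℕ} (x : Fin n → Plane) : ℝ :=
  Finset.univ.sup' Finset.univ_nonempty fun i => Metric.infDist (p i) (hullOf x)

/-- The distance from the `i`-th vertex to the chord that cuts off the lengths `y (i, true)` and
`y (i, false)` on its two edges. -/
noncomputable def cornerDist (p : Polygon Plane M) (i : Fin M) (y : Fin M × Bool → ℝ) : ℝ :=
  Metric.infDist 0 (segment ℝ (y (i, true) • p.sideDir (i, true))
    (y (i, false) • p.sideDir (i, false)))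

noncomputable def maxCornerDist [NeZero M] (p : Polygon Plane M) (y : Fin M × Bool → ℝ) : ℝ :=
  Finset.univ.sup' Finset.univ_nonempty fun i => p.cornerDist i y

theorem continuous_maxVertexDist [NeZero M] (p : Polygon Plane M) (n : ℕ) [NeZero n] :
    Continuous fun x : Fin n → Plane => p.maxVertexDist x :=
  Continuous.finset_sup'_apply _ fun i _ => continuous_infDist_hullOf (p i)

theorem continuous_cornerDist (p : Polygon Plane M) (i : Fin M) : Continuous (p.cornerDist i) := by
  have h : Continuous fun y : Fin M × Bool → ℝ => (y (i, true), y (i, false)) := by fun_prop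
  have h' := (continuous_infDist_segment (p.sideDir (i, true)) (p.sideDir (i, false))).comp h
  unfold cornerDist
  simpa only [Function.comp_def] using h'

theorem continuous_maxCornerDist [NeZero M] (p : Polygon Plane M) :
    Continuous p.maxCornerDist := by
  unfold maxCornerDist
  exact Continuous.finset_sup'_apply _ fun i _ => p.continuous_cornerDist i

theorem lt_maxVertexDist_iff [NeZero M] {n : ℕ} {x : Fin n → Plane} {s : ℝ} :
    s < p.maxVertexDist x ↔ ∃ i, s < Metric.infDist (p i) (hullOf x) := by
  simp [maxVertexDist]

theorem lt_maxCornerDist_iff [NeZero M] {y : Fin M × Bool → ℝ} {s : ℝ} :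
    s < p.maxCornerDist y ↔ ∃ i, s < p.cornerDist i y := by
  simp [maxCornerDist]

theorem maxVertexDist_nonneg [NeZero M] (p : Polygon Plane M) {n : ℕ} (x : Fin n → Plane) :
    0 ≤ p.maxVertexDist x :=
  Metric.infDist_nonneg.trans
    (Finset.le_sup' (fun i => Metric.infDist (p i) (hullOf x)) (Finset.mem_univ 0))

theorem lt_maxCornerDist_mul_iff [NeZero M] {y : Fin M × Bool → ℝ} {c t : ℝ} (hc : 0 < c) :
    t < p.maxCornerDist (fun k => c * y k) ↔ t < c * p.maxCornerDist y := by
  rw [← div_lt_iff₀' hc, lt_maxCornerDist_iff, lt_maxCornerDist_iff]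
  simp only [cornerDist, infDist_segment_smul hc, div_lt_iff₀' hc]

theorem infDist_hullOf_le (p : Polygon Plane M) {n : ℕ} [NeZero n] {x : Fin n → Plane}
    (hx : ∀ j, x j ∈ p.region) (i : Fin M) :
    Metric.infDist (p i) (hullOf x) ≤ Metric.diam p.region :=
  (Metric.infDist_le_dist_of_mem (subset_convexHull ℝ _ (Set.mem_range_self 0))).trans
    (Metric.dist_le_diam_of_mem p.isCompact_region.isBounded (p.vertex_mem_region i) (hx 0))

theorem frontier_region_subset (p : Polygon Plane M) : frontier p.region ⊆ p.region :=
  p.isCompact_region.isClosed.frontier_subset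

namespace IsConvex

/-- The hypothesis `hgap` says that every edge carries a sample point, since the default gap is
larger than the edge. The chord at the vertex then joins two sample points, and no sample point lies
on the near side of it. -/
theorem infDist_hullOf_eq_cornerDist (hM : 3 ≤ M) (hp : p.IsConvex) {n : ℕ} [NeZero n]
    {x : Fin n → Plane} (hx : ∀ j, x j ∈ frontier p.region)
    (hgap : ∀ k, p.sampleGap x k ≤ p.sideLength k) (i : Fin M) :
    Metric.infDist (p i) (hullOf x) = p.cornerDist i (p.sampleGap x) := by
  have h0 : ∀ k, 0 ≤ p.sampleGap x k := fun k => by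
    obtain ⟨j, hj⟩ := exists_sampleGap_eq x k
    rw [hj]
    exact p.gap_nonneg _ _
  have hmem : ∀ k, p k.1 + p.sampleGap x k • p.sideDir k ∈ Set.range x := fun k => by
    obtain ⟨j, hj⟩ := exists_sampleGap_eq x k
    obtain ⟨r, hr0, hr1, hr⟩ := (hp.gap_le_iff hM le_rfl).1 (hj ▸ hgap k)
    refine ⟨j, ?_⟩
    rw [hj, hr, hp.gap_add_smul_sideDir hM hr0 hr1]
  have hside : ∀ k j, x j ∈ p.side k → ∃ r, p.sampleGap x k ≤ r ∧
      x j = p k.1 + r • p.sideDir k := fun k j hj => by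
    obtain ⟨r, hr0, hr1, hr⟩ := (hp.mem_side_iff hM).1 hj
    refine ⟨r, ?_, hr⟩
    have := sampleGap_le (p := p) x k j
    rwa [hr, hp.gap_add_smul_sideDir hM hr0 hr1] at this
  refine infDist_convexHull_corner (h0 _) (h0 _) (hmem (i, true)) (hmem (i, false)) ?_
  rintro _ ⟨j, rfl⟩
  have hs := h0 (i, true)
  have ht := h0 (i, false)
  rcases hp.frontier_coordinates hM i (hx j) with h | h | ⟨a, b, ha, hb, hab, h⟩
  · obtain ⟨r, hr, hxj⟩ := hside (i, true) j h
    refine ⟨r, 0, hs.trans hr, le_rfl, by rw [hxj]; simp, ?_⟩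
    rw [zero_mul, add_zero]
    exact mul_le_mul_of_nonneg_right hr ht
  · obtain ⟨r, hr, hxj⟩ := hside (i, false) j h
    refine ⟨0, r, le_rfl, ht.trans hr, by rw [hxj]; simp, ?_⟩
    rw [zero_mul, zero_add, mul_comm]
    exact mul_le_mul_of_nonneg_right hr hs
  · have hl := hp.sideLength_pos hM (i, true)
    have hl' := hp.sideLength_pos hM (i, false)
    refine ⟨a * p.sideLength (i, true), b * p.sideLength (i, false), by positivity, by positivity,
      ?_, ?_⟩
    · rw [mul_smul, mul_smul, hp.sideLength_smul_sideDir hM, hp.sideLength_smul_sideDir hM]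
      exact h
    -- Such a point is beyond the line through the neighbouring vertices, and the legs of the chord
    -- are no longer than the sides.
    · have h1 := mul_le_mul_of_nonneg_left (mul_le_mul_of_nonneg_right (hgap (i, true)) ht) ha
      have h2 := mul_le_mul_of_nonneg_left (mul_le_mul_of_nonneg_right (hgap (i, false)) hs) hb
      have h3 := mul_le_mul_of_nonneg_right hab (mul_nonneg hs ht)
      linarith

theorem maxVertexDist_eq_maxCornerDist [NeZero M] (hM : 3 ≤ M) (hp : p.IsConvex) {n : ℕ} [NeZero n]
    {x : Fin n → Plane} (hx : ∀ j, x j ∈ frontier p.region)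
    (hgap : ∀ k, p.sampleGap x k ≤ p.sideLength k) :
    p.maxVertexDist x = p.maxCornerDist (p.sampleGap x) := by
  simp only [maxVertexDist, maxCornerDist, hp.infDist_hullOf_eq_cornerDist hM hx hgap]

theorem sin_interiorAngle_pos (hM : 3 ≤ M) (hp : p.IsConvex) {i : Fin M}
    (hangle : Real.pi / 2 ≤ p.interiorAngle i) : 0 < Real.sin (p.interiorAngle i) := by
  refine Real.sin_pos_of_pos_of_lt_pi (by linarith [Real.pi_pos])
    ((EuclideanGeometry.angle_le_pi _ _ _).lt_of_ne fun h => ?_)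
  have hmem := (EuclideanGeometry.angle_eq_pi_iff_sbtw.1 h).wbtw
  rw [Wbtw, affineSegment_eq_segment] at hmem
  rcases hp.eq_or_eq_of_mem_segment hmem with h | h
  · exact ne_finRotate_symm hM i h
  · exact finRotate_ne hM i h

open scoped RealInnerProductSpace in
theorem inner_sideDir (p : Polygon Plane M) (i : Fin M) :
    ⟪p.sideDir (i, true), p.sideDir (i, false)⟫ = Real.cos (p.interiorAngle i) := by
  rw [interiorAngle, EuclideanGeometry.angle, InnerProductGeometry.cos_angle, sideDir, sideDir,
    inner_smul_left, inner_smul_right, real_inner_comm]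
  simp only [sideLength, neighbor, if_true, Bool.false_eq_true, if_false, conj_trivial,
    vsub_eq_sub, dist_comm (p i), dist_eq_norm]
  rw [div_eq_mul_inv, mul_inv]
  ring

theorem cornerDist_le (hM : 3 ≤ M) (hp : p.IsConvex) {i : Fin M}
    (hangle : Real.pi / 2 ≤ p.interiorAngle i) {y : Fin M × Bool → ℝ} (hy : ∀ k, 0 < y k) :
    p.cornerDist i y ≤ Real.sin (p.interiorAngle i) * min (y (i, true)) (y (i, false)) := by
  refine infDist_segment_le_of_inner_nonpos (c := -Real.cos (p.interiorAngle i))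
    (hp.norm_sideDir hM _) (hp.norm_sideDir hM _) (by rw [inner_sideDir, neg_neg]) ?_
    (hp.sin_interiorAngle_pos hM hangle).le ?_ (hy _) (hy _)
  · rw [neg_nonneg]
    refine Real.cos_nonpos_of_pi_div_two_le_of_le hangle ?_
    have : p.interiorAngle i ≤ Real.pi := EuclideanGeometry.angle_le_pi _ _ _
    linarith [Real.pi_pos]
  · rw [neg_sq]; exact Real.sin_sq_add_cos_sq _

theorem le_cornerDist (hM : 3 ≤ M) (hp : p.IsConvex) {i : Fin M}
    (hangle : Real.pi / 2 ≤ p.interiorAngle i) {y : Fin M × Bool → ℝ} (hy : ∀ k, 0 < y k) :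
    Real.sin (p.interiorAngle i) / 2 * min (y (i, true)) (y (i, false)) ≤ p.cornerDist i y := by
  refine le_infDist_segment_of_inner_nonpos (c := -Real.cos (p.interiorAngle i))
    (hp.norm_sideDir hM _) (hp.norm_sideDir hM _) (by rw [inner_sideDir, neg_neg]) ?_
    ?_ (hy _) (hy _)
  · rw [neg_nonneg]
    refine Real.cos_nonpos_of_pi_div_two_le_of_le hangle ?_
    have : p.interiorAngle i ≤ Real.pi := EuclideanGeometry.angle_le_pi _ _ _
    linarith [Real.pi_pos]
  · rw [neg_sq]; exact Real.sin_sq_add_cos_sq _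

/-- With high probability every edge carries a sample point. -/
theorem tendsto_measureReal_exists_lt_sampleGap (hM : 3 ≤ M) (hp : p.IsConvex) :
    Tendsto (fun n : ℕ => (p.sampleLaw (n + 1)).real
      {x | ∃ k, p.sideLength k < p.sampleGap x k}) atTop (𝓝 0) := by
  have hk : ∀ k, Tendsto (fun n : ℕ => p.uniformBoundary.real
      {z | p.sideLength k < p.gap k z} ^ (n + 1)) atTop (𝓝 0) := by
    intro k
    refine (tendsto_pow_atTop_nhds_zero_of_lt_one measureReal_nonneg ?_).comp
      (tendsto_add_atTop_nat 1)
    rw [hp.measureReal_lt_gap hM (hp.sideLength_pos hM k).le le_rfl]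
    have := div_pos (hp.sideLength_pos hM k) (hp.perimeter_pos hM)
    linarith
  have hsum := tendsto_finsetSum Finset.univ fun k _ => hk k
  rw [Finset.sum_const_zero] at hsum
  refine squeeze_zero (fun _ => measureReal_nonneg) (fun n => ?_) hsum
  have := hp.isProbabilityMeasure_sampleLaw hM (n + 1)
  have hset : {x : Fin (n + 1) → Plane | ∃ k, p.sideLength k < p.sampleGap x k} =
      ⋃ k, {x | ∀ j, x j ∈ {z | p.sideLength k < p.gap k z}} := by
    ext x; simp [lt_sampleGap_iff]
  rw [hset]
  refine (measureReal_iUnion_fintype_le _).trans (Finset.sum_le_sum fun k _ => ?_)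
  rw [measureReal_sampleLaw_forall hM hp]

/-- The true distance and the corner distance of the gaps differ only when some edge is empty, an
event of vanishing probability. The limit for the second, from weak convergence and homogeneity,
passes to the first by squeezing. -/
theorem tendsto_measureReal_lt_maxVertexDist [NeZero M] (hM : 3 ≤ M) (hp : p.IsConvex) {t : ℝ}
    (ht : expPi (Fin M × Bool) p.perimeter⁻¹ {y | p.maxCornerDist y = t} = 0) :
    Tendsto (fun n : ℕ => (p.sampleLaw (n + 1)).real
      {x | t < (n + 1 : ℕ) * p.maxVertexDist x}) atTop
      (𝓝 ((expPi (Fin M × Bool) p.perimeter⁻¹).real {y | t < p.maxCornerDist y})) := by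
  have hprob := fun n => hp.isProbabilityMeasure_sampleLaw hM n
  have hmeas : ∀ n : ℕ, Measurable fun (x : Fin (n + 1) → Plane) (k : Fin M × Bool) =>
      ((n + 1 : ℕ) : ℝ) * p.sampleGap x k := fun n =>
    measurable_pi_lambda _ fun k =>
      ((measurable_pi_apply k).comp (p.measurable_sampleGap (n + 1))).const_mul _
  let ν : ProbabilityMeasure (Fin M × Bool → ℝ) :=
    ⟨expPi (Fin M × Bool) p.perimeter⁻¹,
      isProbabilityMeasure_expPi _ (inv_pos.2 (hp.perimeter_pos hM))⟩
  let μ : ℕ → ProbabilityMeasure (Fin M × Bool → ℝ) := fun n =>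
    ⟨(p.sampleLaw (n + 1)).map fun x k => ((n + 1 : ℕ) : ℝ) * p.sampleGap x k,
      Measure.isProbabilityMeasure_map (hmeas n).aemeasurable⟩
  have hμν : Tendsto μ atTop (𝓝 ν) := by
    refine tendsto_probabilityMeasure_of_tendsto_upperOrthant fun s => ?_
    refine (hp.tendsto_sampleGap_upperOrthant hM s).congr fun n => ?_
    exact (map_measureReal_apply (hmeas n) (measurableSet_upperOrthant s)).symm
  have hcorner : Tendsto (fun n : ℕ => (p.sampleLaw (n + 1)).real
      {x | t < (n + 1 : ℕ) * p.maxCornerDist (p.sampleGap x)}) atTop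
      (𝓝 ((expPi (Fin M × Bool) p.perimeter⁻¹).real {y | t < p.maxCornerDist y})) := by
    refine (tendsto_measureReal_superlevel hμν p.continuous_maxCornerDist ht).congr fun n => ?_
    refine (map_measureReal_apply (hmeas n)
      (measurableSet_lt measurable_const p.continuous_maxCornerDist.measurable)).trans ?_
    congr 1
    ext x
    exact lt_maxCornerDist_mul_iff (by positivity)
  have hbad := hp.tendsto_measureReal_exists_lt_sampleGap hM
  have hae : ∀ n : ℕ, ∀ᵐ x ∂(p.sampleLaw (n + 1)),
      (∃ k, p.sideLength k < p.sampleGap x k) ∨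
        p.maxVertexDist x = p.maxCornerDist (p.sampleGap x) := by
    intro n
    filter_upwards [hp.ae_sampleLaw_mem hM (n + 1)] with x hx
    by_cases h : ∃ k, p.sideLength k < p.sampleGap x k
    · exact Or.inl h
    · push Not at h
      exact Or.inr (hp.maxVertexDist_eq_maxCornerDist hM hx h)
  have hle : ∀ n : ℕ, ∀ f g : (Fin (n + 1) → Plane) → ℝ,
      (∀ᵐ x ∂(p.sampleLaw (n + 1)), (∃ k, p.sideLength k < p.sampleGap x k) ∨ f x = g x) →
      (p.sampleLaw (n + 1)).real {x | t < (n + 1 : ℕ) * f x} ≤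
        (p.sampleLaw (n + 1)).real {x | t < (n + 1 : ℕ) * g x} +
          (p.sampleLaw (n + 1)).real {x | ∃ k, p.sideLength k < p.sampleGap x k} := by
    intro n f g hfg
    refine le_trans ?_ (measureReal_union_le _ _)
    refine ENNReal.toReal_mono (measure_ne_top _ _) (measure_mono_ae ?_)
    filter_upwards [hfg] with x hx hxf
    rcases hx with hx | hx
    · exact Or.inr hx
    · exact Or.inl (show t < (n + 1 : ℕ) * g x from hx ▸ hxf)
  have hlow := hcorner.sub hbad
  have hupp := hcorner.add hbad
  rw [sub_zero] at hlow
  rw [add_zero] at hupp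
  refine tendsto_of_tendsto_of_tendsto_of_le_of_le hlow hupp (fun n => ?_) fun n => ?_
  · rw [sub_le_iff_le_add]
    exact hle n _ _ ((hae n).mono fun x hx => hx.imp_right Eq.symm)
  · exact hle n _ _ (hae n)

/-- Exponential tails of the rescaled distance, uniformly in the sample size. -/
theorem exists_tail_bound [NeZero M] (hM : 3 ≤ M) (hp : p.IsConvex) :
    ∃ c, 0 < c ∧ ∀ n : ℕ, ∀ t, 0 < t →
      (p.sampleLaw (n + 1)).real {x | t < (n + 1 : ℕ) * p.maxVertexDist x} ≤
        M * Real.exp (-c * t) := by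
  have hP := hp.perimeter_pos hM
  set R := Metric.diam p.region with hR
  have hR0 : 0 ≤ R := Metric.diam_nonneg
  -- For `s < R` the length `κ * s` fits on every edge, so the law of the gap is exact there; `κ ≤
  -- 1` makes a sample point within `κ * s` of a vertex also within `s`.
  obtain ⟨κ, hκ0, hκ1, hκ⟩ : ∃ κ : ℝ, 0 < κ ∧ κ ≤ 1 ∧ ∀ i, κ * R ≤ p.sideLength (i, true) := by
    obtain ⟨i₀, -, hi₀⟩ := Finset.exists_min_image Finset.univ
      (fun i : Fin M => p.sideLength (i, true)) Finset.univ_nonempty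
    have hl := hp.sideLength_pos hM (i₀, true)
    refine ⟨p.sideLength (i₀, true) / (p.sideLength (i₀, true) + R), by positivity,
      (div_le_one (by positivity)).2 (by linarith), fun i => ?_⟩
    refine le_trans ?_ (hi₀ i (Finset.mem_univ i))
    rw [div_mul_eq_mul_div, div_le_iff₀ (by positivity)]
    nlinarith
  refine ⟨κ / p.perimeter, by positivity, fun n t ht => ?_⟩
  have := hp.isProbabilityMeasure_sampleLaw hM (n + 1)
  have := hp.isProbabilityMeasure_uniformBoundary hM
  have hn0 : (0 : ℝ) < (n + 1 : ℕ) := by positivity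
  set s := t / (n + 1 : ℕ) with hs
  have hs0 : 0 < s := by positivity
  -- A vertex farther than `s` from the hull has no sample point within `κ * s` on its forward edge.
  -- For `s ≥ R` this is almost surely impossible. The union over vertices gives the factor `M`.
  have hsub : ({x | t < (n + 1 : ℕ) * p.maxVertexDist x} : Set (Fin (n + 1) → Plane))
      ≤ᵐ[p.sampleLaw (n + 1)]
        ((⋃ i : Fin M, {x | s < R ∧ ∀ j, x j ∈ {z | κ * s < p.gap (i, true) z}} :
          Set (Fin (n + 1) → Plane))) := by
    filter_upwards [hp.ae_sampleLaw_mem hM (n + 1)] with x hx hlt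
    replace hlt : t < (n + 1 : ℕ) * p.maxVertexDist x := hlt
    rw [← div_lt_iff₀' hn0, lt_maxVertexDist_iff] at hlt
    obtain ⟨i, hi⟩ := hlt
    refine Set.mem_iUnion.2 ⟨i, ?_, fun j => ?_⟩
    · exact hi.trans_le (p.infDist_hullOf_le (fun j => p.frontier_region_subset (hx j)) i)
    · have hsR : s < R :=
        hi.trans_le (p.infDist_hullOf_le (fun j => p.frontier_region_subset (hx j)) i)
      change κ * s < p.gap (i, true) (x j)
      by_contra! hle
      have hκs : κ * s ≤ p.sideLength (i, true) :=
        (mul_le_mul_of_nonneg_left hsR.le hκ0.le).trans (hκ i)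
      obtain ⟨r, hr0, hr1, hr⟩ := (hp.gap_le_iff hM hκs).1 hle
      have hd : Metric.infDist (p i) (hullOf x) ≤ dist (p i) (x j) :=
        Metric.infDist_le_dist_of_mem (subset_convexHull ℝ _ (Set.mem_range_self j))
      rw [hr, dist_self_add_right, norm_smul, hp.norm_sideDir hM, mul_one,
        Real.norm_of_nonneg hr0] at hd
      nlinarith
  refine (ENNReal.toReal_mono (measure_ne_top _ _) (measure_mono_ae hsub)).trans ?_
  refine (measureReal_iUnion_fintype_le _).trans ?_
  have hterm : ∀ i : Fin M, (p.sampleLaw (n + 1)).real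
      {x | s < R ∧ ∀ j, x j ∈ {z | κ * s < p.gap (i, true) z}} ≤
        Real.exp (-(κ / p.perimeter) * t) := by
    intro i
    by_cases hsR : s < R
    · have hκs : κ * s ≤ p.sideLength (i, true) :=
        (mul_le_mul_of_nonneg_left hsR.le hκ0.le).trans (hκ i)
      simp only [hsR, true_and]
      rw [measureReal_sampleLaw_forall hM hp]
      have hle : p.uniformBoundary.real {z | κ * s < p.gap (i, true) z} ≤
          Real.exp (-(κ * s / p.perimeter)) := by
        rw [hp.measureReal_lt_gap hM (by positivity) hκs]
        exact Real.one_sub_le_exp_neg _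
      refine (pow_le_pow_left₀ measureReal_nonneg hle (n + 1)).trans_eq ?_
      rw [← Real.exp_nat_mul]
      congr 1
      rw [hs]
      field_simp
    · simp only [hsR, false_and]
      simpa using Real.exp_nonneg _
  refine (Finset.sum_le_sum fun i _ => hterm i).trans_eq ?_
  simp

theorem integrable_maxVertexDist [NeZero M] (hM : 3 ≤ M) (hp : p.IsConvex) (n : ℕ) [NeZero n] :
    Integrable (fun x : Fin n → Plane => p.maxVertexDist x) (p.sampleLaw n) := by
  have := hp.isProbabilityMeasure_sampleLaw hM n
  refine Integrable.of_bound (p.continuous_maxVertexDist n).aestronglyMeasurable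
    (Metric.diam p.region) ?_
  filter_upwards [hp.ae_sampleLaw_mem hM n] with x hx
  rw [Real.norm_of_nonneg (p.maxVertexDist_nonneg x)]
  exact Finset.sup'_le _ _ fun i _ =>
    p.infDist_hullOf_le (fun j => p.frontier_region_subset (hx j)) i

/-- The rescaled mean distance converges to the mean of the limit variable. -/
theorem tendsto_integral_maxVertexDist [NeZero M] (hM : 3 ≤ M) (hp : p.IsConvex) :
    Tendsto (fun n : ℕ => ((n + 1 : ℕ) : ℝ) * ∫ x, p.maxVertexDist x ∂(p.sampleLaw (n + 1))) atTop
      (𝓝 (∫ t in Set.Ioi 0,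
        (expPi (Fin M × Bool) p.perimeter⁻¹).real {y | t < p.maxCornerDist y})) := by
  have := fun n => hp.isProbabilityMeasure_sampleLaw hM n
  have := isProbabilityMeasure_expPi (Fin M × Bool) (inv_pos.2 (hp.perimeter_pos hM))
  obtain ⟨c, hc, htail⟩ := hp.exists_tail_bound hM
  simp_rw [← integral_const_mul]
  refine tendsto_integral_of_tendsto_tail
    (Eventually.of_forall fun n => (hp.integrable_maxVertexDist hM (n + 1)).const_mul _)
    (fun n x => mul_nonneg (by positivity) (p.maxVertexDist_nonneg x)) hc
    (Eventually.of_forall htail) (ae_restrict_of_ae ?_)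
  filter_upwards [ae_measure_level_eq_zero (ν := expPi (Fin M × Bool) p.perimeter⁻¹)
    p.continuous_maxCornerDist.measurable] with t ht
  exact hp.tendsto_measureReal_lt_maxVertexDist hM ht

/-- The corner bounds sandwich the tail between those of maxima of weighted minima. With weights
`sin α_i` the mean is `A(Q)/2`, the half coming from the doubled rate; halving all weights halves it
again. -/
theorem integral_tail_bounds [NeZero M] (hM : 3 ≤ M) (hp : p.IsConvex)
    (hangle : ∀ i, Real.pi / 2 ≤ p.interiorAngle i) :
    (∫ t in Set.Ioi 0, (expPi (Fin M × Bool) p.perimeter⁻¹).real {y | t < p.maxCornerDist y}) ∈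
      Set.Icc (p.angleConstant / 4) (p.angleConstant / 2) := by
  have hP := hp.perimeter_pos hM
  have hr : 0 < p.perimeter⁻¹ := inv_pos.2 hP
  have := isProbabilityMeasure_expPi (Fin M × Bool) hr
  have hsin : ∀ i, 0 < Real.sin (p.interiorAngle i) := fun i =>
    hp.sin_interiorAngle_pos hM (hangle i)
  have hsin2 : ∀ i, 0 < Real.sin (p.interiorAngle i) / 2 := fun i => half_pos (hsin i)
  have hlow : ∀ t : ℝ, (expPi (Fin M × Bool) p.perimeter⁻¹).real
      {y | ∃ i, t < Real.sin (p.interiorAngle i) / 2 * min (y (i, true)) (y (i, false))} ≤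
      (expPi (Fin M × Bool) p.perimeter⁻¹).real {y | t < p.maxCornerDist y} := fun t => by
    refine ENNReal.toReal_mono (measure_ne_top _ _) (measure_mono_ae ?_)
    filter_upwards [ae_expPi_pos (Fin M × Bool) hr] with y hy
    rintro ⟨i, hi⟩
    exact lt_maxCornerDist_iff.2 ⟨i, hi.trans_le (hp.le_cornerDist hM (hangle i) hy)⟩
  have hupp : ∀ t : ℝ, (expPi (Fin M × Bool) p.perimeter⁻¹).real {y | t < p.maxCornerDist y} ≤
      (expPi (Fin M × Bool) p.perimeter⁻¹).real
      {y | ∃ i, t < Real.sin (p.interiorAngle i) * min (y (i, true)) (y (i, false))} := fun t => by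
    refine ENNReal.toReal_mono (measure_ne_top _ _) (measure_mono_ae ?_)
    filter_upwards [ae_expPi_pos (Fin M × Bool) hr] with y hy hyt
    obtain ⟨i, hi⟩ := lt_maxCornerDist_iff.1 hyt
    exact ⟨i, hi.trans_le (hp.cornerDist_le hM (hangle i) hy)⟩
  have hint : IntegrableOn (fun t => (expPi (Fin M × Bool) p.perimeter⁻¹).real
      {y | t < p.maxCornerDist y}) (Set.Ioi 0) := by
    refine (integrableOn_measureReal_exists_min hr hsin).mono' ?_
      (Eventually.of_forall fun t => ?_)
    · refine (Antitone.measurable fun s t hst => ?_).aestronglyMeasurable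
      exact measureReal_mono fun y hy => hst.trans_lt hy
    · rw [Real.norm_of_nonneg measureReal_nonneg]
      exact hupp t
  have h1 := setIntegral_mono (integrableOn_measureReal_exists_min hr hsin2) hint hlow
  have h2 := setIntegral_mono hint (integrableOn_measureReal_exists_min hr hsin) hupp
  rw [integral_measureReal_exists_min hr hsin2] at h1
  rw [integral_measureReal_exists_min hr hsin] at h2
  have hhalf : ∀ S : Finset (Fin M),
      1 / ∑ i ∈ S, 1 / (Real.sin (p.interiorAngle i) / 2) =
        (1 / ∑ i ∈ S, 1 / Real.sin (p.interiorAngle i)) / 2 := fun S => by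
    have : ∀ i, 1 / (Real.sin (p.interiorAngle i) / 2) = 2 * (1 / Real.sin (p.interiorAngle i)) :=
      fun i => by field_simp
    simp only [this]
    rw [← Finset.mul_sum, one_div, mul_inv, one_div]
    ring
  simp only [hhalf, ← Finset.sum_div, ← mul_div_assoc, Fintype.card_fin] at h1 h2
  refine ⟨le_trans (le_of_eq ?_) h1, h2.trans_eq ?_⟩
  · rw [angleConstant, mul_inv, inv_inv]
    ring
  · rw [angleConstant, mul_inv, inv_inv]
    ring

end IsConvex

end Polygon

/-! ### Transfer to arbitrary probability spaces. -/

theorem corollary2 {M : ℕ} (hM : 3 ≤ M) (p : Polygon Plane M) (hp : p.IsConvex)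
    (hangle : ∀ i, Real.pi / 2 ≤ p.interiorAngle i)
    (Ω : ℕ → Type*) [∀ n, MeasurableSpace (Ω n)]
    (P : ∀ n, Measure (Ω n)) [∀ n, IsProbabilityMeasure (P n)]
    (X : ∀ n, Fin n → Ω n → Plane)
    (hindep : ∀ n, 3 ≤ n → iIndepFun (X n) (P n))
    (hunif : ∀ n, 3 ≤ n → ∀ j,
      pdf.IsUniform (X n j) (frontier p.region) (P n) (Measure.hausdorffMeasure 1)) :
    (∀ n, 3 ≤ n →
      Integrable (fun ω => Metric.hausdorffDist p.region (hullOf fun j => X n j ω)) (P n)) ∧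
    ∃ L : ℝ,
      Tendsto
        (fun n : ℕ =>
          (n : ℝ) * ∫ ω, Metric.hausdorffDist p.region (hullOf fun j => X n j ω) ∂(P n))
        atTop (𝓝 L) ∧
      (1 / 5 : ℝ) * p.angleConstant ≤ L ∧ L ≤ p.angleConstant := by
  have : NeZero M := ⟨by omega⟩
  -- A map that is not a.e. measurable pushes forward to zero, which the uniform law is not.
  have hX : ∀ n, 3 ≤ n → ∀ j, AEMeasurable (X n j) (P n) := fun n hn j =>
    (hunif n hn j).aemeasurable (hp.hausdorffMeasure_frontier_ne_zero hM)
      (hp.hausdorffMeasure_frontier_ne_top hM)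
  have hXm : ∀ n, 3 ≤ n → AEMeasurable (fun ω j => X n j ω) (P n) := fun n hn =>
    aemeasurable_pi_iff.2 (hX n hn)
  have hlaw : ∀ n, 3 ≤ n → (P n).map (fun ω j => X n j ω) = p.sampleLaw n := by
    intro n hn
    rw [(iIndepFun_iff_map_fun_eq_pi_map (hX n hn)).1 (hindep n hn), Polygon.sampleLaw]
    congr 1
    ext1 j
    exact hunif n hn j
  have heq : ∀ n, 3 ≤ n → (fun ω => Metric.hausdorffDist p.region (hullOf fun j => X n j ω))
      =ᵐ[P n] fun ω => p.maxVertexDist fun j => X n j ω := by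
    intro n hn
    have : NeZero n := ⟨by omega⟩
    have hmem := hp.ae_sampleLaw_mem hM n
    rw [← hlaw n hn] at hmem
    filter_upwards [ae_of_ae_map (hXm n hn) hmem] with ω hω
    exact hausdorffDist_convexHull_range p.vertices fun j => p.frontier_region_subset (hω j)
  refine ⟨fun n hn => ?_, ?_⟩
  · have : NeZero n := ⟨by omega⟩
    have hint := hp.integrable_maxVertexDist hM n
    rw [← hlaw n hn] at hint
    exact (hint.comp_aemeasurable (hXm n hn)).congr (heq n hn).symm
  · obtain ⟨hlow, hupp⟩ := hp.integral_tail_bounds hM hangle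
    refine ⟨_, ?_, le_trans ?_ hlow, hupp.trans ?_⟩
    · rw [← tendsto_add_atTop_iff_nat 1]
      refine (hp.tendsto_integral_maxVertexDist hM).congr' ?_
      filter_upwards [eventually_ge_atTop 2] with n hn
      have hn3 : 3 ≤ n + 1 := by omega
      rw [integral_congr_ae (heq (n + 1) hn3), ← hlaw (n + 1) hn3,
        integral_map (hXm (n + 1) hn3) (p.continuous_maxVertexDist (n + 1)).aestronglyMeasurable]
    -- The bounds `A/4 ≤ L ≤ A/2` themselves force `A ≥ 0`, so the weaker constants `1/5` and `1`
    -- follow.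
    · linarith
    · linarith
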